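/- **Lemma (Establishing a New Norm).** Let $d=2$ or $d=3$. Let $\mathcal{T}_h$ be a conforming simplicial mesh in $\mathbb{R}^d$, that is, a finite collection of nondegenerate closed $d$-simplices (elements) $K$ any two of which are either disjoint or meet in a common face, and let $\Omega$ be the interior of $\bigcup_{K\in\mathcal{T}_h}K$. Let $\mathcal{F}_h$ be the set of all $(d-1)$-dimensional faces $F$ of the elements, and let $h_F$ be the diameter of $F$. Let $$\boldsymbol{H}^1(\mathcal{T}_h)=\{\boldsymbol{w}\in L^2(\Omega)^d:\ \boldsymbol{w}|_K\in H^1(K)^d\ \text{ for all } K\in\mathcal{T}_h\},$$ and let $\nabla_h$ and $\nabla_h\cdot$ denote the gradient and the divergence taken element by element. If $F$ is shared by two elements, one of them is called $K_+$ and the other $K_-$ (by an arbitrary choice), and $[\![\boldsymbol{w}]\!]=\boldsymbol{w}_+-\boldsymbol{w}_-$ is the difference of the traces on $F$ of $\boldsymbol{w}|_{K_+}$ and $\boldsymbol{w}|_{K_-}$; if $F$ belongs to only one element (a boundary face), $[\![\boldsymbol{w}]\!]$ is the trace of $\boldsymbol{w}$ on $F$. Then the traces are well-defined elements of $L^2(F)^d$,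 and $$|||\boldsymbol{w}|||_{\mathrm{sym}}=\left(\left\|\nabla_h\boldsymbol{w}+\nabla_h\boldsymbol{w}^T-\tfrac23(\nabla_h\cdot\boldsymbol{w})\,\mathbb{I}\right\|_{L^2(\Omega)}^2+\sum_{F\in\mathcal{F}_h}\frac1{h_F}\left\|[\![\boldsymbol{w}]\!]\right\|_{L^2(F)}^2\right)^{1/2}$$ (with the Frobenius norm for matrices) is a norm on $\boldsymbol{H}^1(\mathcal{T}_h)$: for all $\boldsymbol{v},\boldsymbol{w}\in\boldsymbol{H}^1(\mathcal{T}_h)$ and $c\in\mathbb{R}$ it is nonnegative, vanishes if and only if $\boldsymbol{w}=0$ (almost everywhere), and satisfies $|||c\boldsymbol{w}|||_{\mathrm{sym}}=|c|\,|||\boldsymbol{w}|||_{\mathrm{sym}}$ and $|||\boldsymbol{v}+\boldsymbol{w}|||_{\mathrm{sym}}\le|||\boldsymbol{v}|||_{\mathrm{sym}}+|||\boldsymbol{w}|||_{\mathrm{sym}}$. -/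

import Mathlib

open MeasureTheory Filter
open scoped Topology ENNReal ContDiff

noncomputable section

namespace BrokenSobolev

/-- `d`-dimensional Euclidean space. -/
abbrev Space (d : ℕ) : Type := EuclideanSpace ℝ (Fin d)

/-! ### Weak derivatives and the Sobolev space `H¹(U)` -/

/-- `g` is a weak partial derivative `∂f/∂x_j` on `U`, tested against `C_c^∞(U)`. -/
def HasWeakPartial {d : ℕ} (U : Set (Space d)) (f : Space d → ℝ) (j : Fin d)
    (g : Space d → ℝ) : Prop :=
  ∀ φ : Space d → ℝ, ContDiff ℝ ∞ φ → HasCompactSupport φ → tsupport φ ⊆ U →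
    ∫ x in U, f x * fderiv ℝ φ x (EuclideanSpace.single j 1) = - ∫ x in U, g x * φ x

/-- `f ∈ H¹(U)`: `f` and all its first order weak partial derivatives lie in `L²(U)`. -/
def MemH1 {d : ℕ} (U : Set (Space d)) (f : Space d → ℝ) : Prop :=
  MemLp f 2 (volume.restrict U) ∧
    ∀ j : Fin d, ∃ g : Space d → ℝ, MemLp g 2 (volume.restrict U) ∧ HasWeakPartial U f j g

open Classical in
/-- The weak partial derivative `∂f/∂x_j ∈ L²(U)` of a function `f ∈ H¹(U)`; it is determined
almost everywhere on `U` (see `HasWeakPartial.ae_unique`). -/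
def weakPartial {d : ℕ} (U : Set (Space d)) (f : Space d → ℝ) (j : Fin d) : Space d → ℝ :=
  if h : ∃ g : Space d → ℝ, MemLp g 2 (volume.restrict U) ∧ HasWeakPartial U f j g
  then h.choose else 0

lemma MemH1.weakPartial_spec {d : ℕ} {U : Set (Space d)} {f : Space d → ℝ} (hf : MemH1 U f)
    (j : Fin d) : MemLp (weakPartial U f j) 2 (volume.restrict U) ∧
      HasWeakPartial U f j (weakPartial U f j) := by
  have h := hf.2 j
  rw [weakPartial, dif_pos h]
  exact h.choose_spec

/-- Test functions and their derivatives are square integrable. -/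
lemma memLp_testFunction {d : ℕ} (U : Set (Space d)) {φ : Space d → ℝ} (hφ : ContDiff ℝ ∞ φ)
    (hc : HasCompactSupport φ) : MemLp φ 2 (volume.restrict U) :=
  (hφ.continuous.memLp_of_hasCompactSupport hc).restrict U

lemma memLp_testFunction_fderiv {d : ℕ} (U : Set (Space d)) {φ : Space d → ℝ}
    (hφ : ContDiff ℝ ∞ φ) (hc : HasCompactSupport φ) (v : Space d) :
    MemLp (fun x => fderiv ℝ φ x v) 2 (volume.restrict U) := by
  have h1 : Continuous (fun x => fderiv ℝ φ x v) :=
    (hφ.continuous_fderiv (by simp)).clm_apply continuous_const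
  have h2 : HasCompactSupport (fun x => fderiv ℝ φ x v) := hc.fderiv_apply (𝕜 := ℝ) v
  exact (h1.memLp_of_hasCompactSupport h2).restrict U

/-- Weak partial derivatives in `L²` are unique up to null sets. -/
lemma HasWeakPartial.ae_unique {d : ℕ} {U : Set (Space d)} (hU : IsOpen U) {f : Space d → ℝ}
    {j : Fin d} {g h : Space d → ℝ} (hg : MemLp g 2 (volume.restrict U))
    (hh : MemLp h 2 (volume.restrict U)) (hfg : HasWeakPartial U f j g)
    (hfh : HasWeakPartial U f j h) : g =ᵐ[volume.restrict U] h := by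
  have hgh : MemLp (g - h) 2 (volume.restrict U) := hg.sub hh
  have hloc : LocallyIntegrableOn (g - h) U volume := by
    rw [locallyIntegrableOn_iff hU.isLocallyClosed]
    intro k hkU hk
    have : IsFiniteMeasure (volume.restrict k) := ⟨by simpa using hk.measure_lt_top⟩
    exact (hgh.mono_measure (Measure.restrict_mono hkU le_rfl)).integrable (by norm_num)
  have key := hU.ae_eq_zero_of_integral_contDiff_smul_eq_zero hloc (by
    intro φ hφ hc hs
    have hφ2 := memLp_testFunction U hφ hc
    have e : ∫ x, φ x • (g - h) x = ∫ x in U, φ x • (g - h) x := by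
      symm
      refine setIntegral_eq_integral_of_forall_compl_eq_zero fun x hx => ?_
      have : φ x = 0 := image_eq_zero_of_notMem_tsupport fun hx' => hx (hs hx')
      simp [this]
    have i1 : Integrable (fun x => g x * φ x) (volume.restrict U) := hg.integrable_mul hφ2
    have i2 : Integrable (fun x => h x * φ x) (volume.restrict U) := hh.integrable_mul hφ2
    have e2 : (fun x => φ x • (g - h) x) = fun x => g x * φ x - h x * φ x := by
      funext x
      simp only [Pi.sub_apply, smul_eq_mul]
      ring
    rw [e, e2, integral_sub i1 i2]
    have := (hfg φ hφ hc hs).symm.trans (hfh φ hφ hc hs)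
    linarith)
  have hm := (ae_restrict_iff' hU.measurableSet).2 key
  filter_upwards [hm] with x hx
  have : g x - h x = 0 := hx
  linarith

lemma MemH1.congr {d : ℕ} {U : Set (Space d)} {f g : Space d → ℝ} (hf : MemH1 U f)
    (h : f =ᵐ[volume.restrict U] g) : MemH1 U g := by
  refine ⟨hf.1.ae_eq h, fun j => ?_⟩
  obtain ⟨k, hk, hw⟩ := hf.2 j
  refine ⟨k, hk, fun φ hφ hc hs => ?_⟩
  rw [← hw φ hφ hc hs]
  refine integral_congr_ae ?_
  filter_upwards [h] with x hx
  rw [hx]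

lemma MemH1.zero {d : ℕ} (U : Set (Space d)) : MemH1 U (fun _ => (0 : ℝ)) :=
  ⟨MemLp.zero', fun _ => ⟨fun _ => 0, MemLp.zero', fun φ _ _ _ => by simp⟩⟩

lemma MemH1.add {d : ℕ} {U : Set (Space d)} {f g : Space d → ℝ} (hf : MemH1 U f)
    (hg : MemH1 U g) : MemH1 U (fun x => f x + g x) := by
  refine ⟨hf.1.add hg.1, fun j => ?_⟩
  obtain ⟨k, hk, hwk⟩ := hf.2 j
  obtain ⟨l, hl, hwl⟩ := hg.2 j
  refine ⟨fun x => k x + l x, hk.add hl, fun φ hφ hc hs => ?_⟩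
  have hφ2 := memLp_testFunction U hφ hc
  have hd2 := memLp_testFunction_fderiv U hφ hc (EuclideanSpace.single j 1)
  have i1 : Integrable (fun x => f x * fderiv ℝ φ x (EuclideanSpace.single j 1))
      (volume.restrict U) := hf.1.integrable_mul hd2
  have i2 : Integrable (fun x => g x * fderiv ℝ φ x (EuclideanSpace.single j 1))
      (volume.restrict U) := hg.1.integrable_mul hd2
  have i3 : Integrable (fun x => k x * φ x) (volume.restrict U) := hk.integrable_mul hφ2
  have i4 : Integrable (fun x => l x * φ x) (volume.restrict U) := hl.integrable_mul hφ2
  simp only [add_mul]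
  rw [integral_add i1 i2, integral_add i3 i4, hwk φ hφ hc hs, hwl φ hφ hc hs]
  ring

lemma MemH1.const_mul {d : ℕ} {U : Set (Space d)} {f : Space d → ℝ} (hf : MemH1 U f) (c : ℝ) :
    MemH1 U (fun x => c * f x) := by
  refine ⟨hf.1.const_mul c, fun j => ?_⟩
  obtain ⟨k, hk, hwk⟩ := hf.2 j
  refine ⟨fun x => c * k x, hk.const_mul c, fun φ hφ hc hs => ?_⟩
  simp only [mul_assoc, integral_const_mul]
  rw [hwk φ hφ hc hs]
  ring

/-! ### Conforming simplicial meshes -/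

/-- A conforming simplicial mesh in `ℝ^d`: a finite simplicial complex all of whose simplices are
faces of `d`-dimensional simplices. Simplices are recorded by their vertex sets; Mathlib's
`Geometry.SimplicialComplex` contains that they are nondegenerate and that two of them meet in a
common face or not at all (no overlaps, no hanging nodes). -/
structure SimplicialMesh (d : ℕ) extends Geometry.SimplicialComplex ℝ (Space d) where
  finite_faces : faces.Finite
  pure_dim : ∀ s ∈ faces, ∃ t ∈ faces, s ⊆ t ∧ t.card = d + 1

/-- The open simplex with the vertex set `K`. -/
def openCell {d : ℕ} (K : Finset (Space d)) : Set (Space d) :=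
  interior (convexHull ℝ (K : Set (Space d)))

/-- The `(d-1)`-dimensional surface measure on the closed face with the vertex set `F`. -/
def surfaceMeasure {d : ℕ} (F : Finset (Space d)) : Measure (Space d) :=
  (Measure.euclideanHausdorffMeasure (d - 1)).restrict (convexHull ℝ (F : Set (Space d)))

/-- `g ∈ L²(F)` is the trace on `F` of the vector field `w ∈ H¹(K)^d`: there are fields `u n`,
smooth up to the boundary, with `u n → w` in `H¹(K)` and `u n → g` in `L²(F)`; that is, the trace
operator is the continuous extension of the restriction map. -/
def HasTrace {d : ℕ} (K F : Finset (Space d)) (w : Space d → Space d)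
    (g : Lp (Space d) 2 (surfaceMeasure F)) : Prop :=
  ∃ u : ℕ → Space d → Space d, (∀ n, ContDiff ℝ ∞ (u n)) ∧
    Tendsto (fun n => eLpNorm (fun x => u n x - w x) 2 (volume.restrict (openCell K)))
      atTop (𝓝 0) ∧
    (∀ i j : Fin d, Tendsto (fun n => eLpNorm
        (fun x => fderiv ℝ (u n) x (EuclideanSpace.single j 1) i -
          weakPartial (openCell K) (fun y => w y i) j x) 2 (volume.restrict (openCell K)))
      atTop (𝓝 0)) ∧
    Tendsto (fun n => eLpNorm (fun x => u n x - g x) 2 (surfaceMeasure F)) atTop (𝓝 0)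

open Classical in
/-- The trace on `F` of the vector field `w ∈ H¹(K)^d`. -/
def trace {d : ℕ} (K F : Finset (Space d)) (w : Space d → Space d) :
    Lp (Space d) 2 (surfaceMeasure F) :=
  if h : ∃ g : Lp (Space d) 2 (surfaceMeasure F), HasTrace K F w g then h.choose else 0

namespace SimplicialMesh

variable {d : ℕ} (T : SimplicialMesh d)

/-- The elements `K` of the mesh: its `d`-dimensional simplices. -/
def elements : Finset (Finset (Space d)) :=
  T.finite_faces.toFinset.filter (fun s => s.card = d + 1)

/-- The collection of all faces `F` of the mesh: its `(d-1)`-dimensional simplices. -/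
def meshFaces : Finset (Finset (Space d)) :=
  T.finite_faces.toFinset.filter (fun s => s.card = d)

/-- The domain `Ω` covered by the mesh: the interior of the union of the closed elements. -/
def domain : Set (Space d) := interior T.space

lemma openCell_subset_domain {K : Finset (Space d)} (hK : K ∈ T.elements) :
    openCell K ⊆ T.domain := by
  refine interior_mono (Geometry.SimplicialComplex.convexHull_subset_space ?_)
  have := (Finset.mem_filter.1 hK).1
  simpa using this

/-- The broken Sobolev space `H¹(T_h)^d`: vector fields `w ∈ L²(Ω)^d` whose restriction to each
element `K` lies in `H¹(K)^d`. -/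
def brokenH1 : Submodule ℝ (Lp (Space d) 2 (volume.restrict T.domain)) where
  carrier := {w | ∀ K ∈ T.elements, ∀ i : Fin d, MemH1 (openCell K) (fun x => w x i)}
  zero_mem' := by
    intro K hK i
    refine (MemH1.zero (openCell K)).congr ?_
    have h := ae_restrict_of_ae_restrict_of_subset (T.openCell_subset_domain hK)
      (Lp.coeFn_zero (Space d) 2 (volume.restrict T.domain))
    filter_upwards [h] with x hx
    show (0 : ℝ) = ((0 : Lp (Space d) 2 (volume.restrict T.domain)) : Space d → Space d) x i
    rw [hx]
    rfl
  add_mem' := by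
    intro v w hv hw K hK i
    refine ((hv K hK i).add (hw K hK i)).congr ?_
    have h := ae_restrict_of_ae_restrict_of_subset (T.openCell_subset_domain hK)
      (Lp.coeFn_add v w)
    filter_upwards [h] with x hx
    show v x i + w x i = ((v + w : Lp (Space d) 2 (volume.restrict T.domain)) : Space d → Space d) x i
    rw [hx]
    rfl
  smul_mem' := by
    intro c w hw K hK i
    refine ((hw K hK i).const_mul c).congr ?_
    have h := ae_restrict_of_ae_restrict_of_subset (T.openCell_subset_domain hK)
      (Lp.coeFn_smul c w)
    filter_upwards [h] with x hx
    show c * w x i = ((c • w : Lp (Space d) 2 (volume.restrict T.domain)) : Space d → Space d) x i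
    rw [hx]
    rfl

variable {T} in
/-- The vector field `Ω → ℝ^d` underlying an element of the broken Sobolev space. -/
def field (w : T.brokenH1) : Space d → Space d :=
  (w : Lp (Space d) 2 (volume.restrict T.domain))

/-- The broken gradient `∇_h w`, with entry `(i, j)` equal to the weak derivative `∂w_i/∂x_j` on
each (open) element. -/
def brokenGrad (w : Space d → Space d) (x : Space d) : Matrix (Fin d) (Fin d) ℝ :=
  Matrix.of fun i j => ∑ K ∈ T.elements,
    (openCell K).indicator (weakPartial (openCell K) (fun y => w y i) j) x

/-- `∇_h w + (∇_h w)ᵀ - (2/3) (∇_h · w) I`. -/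
def stress (w : Space d → Space d) (x : Space d) : Matrix (Fin d) (Fin d) ℝ :=
  T.brokenGrad w x + (T.brokenGrad w x).transpose -
    ((2 / 3 : ℝ) * (T.brokenGrad w x).trace) • (1 : Matrix (Fin d) (Fin d) ℝ)

/-- A choice, for every face of the mesh, of the adjacent element on its positive side. -/
structure Orientation where
  plus : Finset (Space d) → Finset (Space d)
  plus_mem : ∀ F ∈ T.meshFaces, plus F ∈ T.elements
  subset_plus : ∀ F ∈ T.meshFaces, F ⊆ plus F

variable {T}

open Classical in
/-- The jump `[[w]]` on a face `F`: the trace from the positive side minus the trace from the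
other adjacent element. A boundary face has no other adjacent element, so that there the jump is
the trace itself. -/
def jump (σ : T.Orientation) (w : Space d → Space d) (F : Finset (Space d)) :
    Lp (Space d) 2 (surfaceMeasure F) :=
  trace (σ.plus F) F w -
    ∑ K ∈ T.elements.filter (fun K => F ⊆ K ∧ K ≠ σ.plus F), trace K F w

/-- The face diameter `h_F`. -/
def faceDiam (F : Finset (Space d)) : ℝ := Metric.diam (convexHull ℝ (F : Set (Space d)))

/-- `|||w|||_sym`. -/
def symNorm (σ : T.Orientation) (w : T.brokenH1) : ℝ :=
  Real.sqrt ((∫ x in T.domain, ∑ i : Fin d, ∑ j : Fin d, T.stress (field w) x i j ^ 2) +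
    ∑ F ∈ T.meshFaces, (faceDiam F)⁻¹ * ‖jump σ (field w) F‖ ^ 2)

end SimplicialMesh

end BrokenSobolev

end

/-! The only hard axiom is definiteness. Suppose the stress vanishes on `Ω` and all jumps vanish,
and extend `w` by zero to `ℝ^d`. Green's formula on each element turns the distributional gradient
of the extension into the broken gradient plus face terms. On an interior face the two contributions
have opposite normals and cancel because the jump is zero; on a boundary face the trace itself is
zero. So the extension has the broken gradient as its weak gradient on all of `ℝ^d`
(`hasWeakPartial_indicator_domain`).

It remains to show that a compactly supported field with `G + Gᵀ = (2/3)(tr G) I`, where `G` is its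
gradient, is zero (`ae_eq_zero_of_weakPartial_symm`). Mollification preserves this linear relation,
so the field may be taken smooth. Contracting with `G` gives `|G|² + G : Gᵀ = (2/3)(tr G)²`. Two
integrations by parts give `∫ G : Gᵀ = ∫ (tr G)²`, hence `∫ |G|² = -(1/3) ∫ (tr G)²`. Thus `G = 0`,
and a constant field with compact support vanishes. Locally the relation may have nonzero solutions;
the zero extension rules them out.

Traces rest on two facts. Smooth functions are dense in `H¹` of a bounded convex open set
(`MemH1.exists_smooth_approx`): shrink towards an interior point, then mollify. And smooth functions
satisfy a trace inequality (`IsCell.exists_trace_bound`), from the divergence theorem for `g² (x -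
p)` with `p` the vertex opposite to the face; this field is tangential to the other faces. The same
theorem for `g (x - p)`, combined linearly over the vertices `p`, yields Green's formula.

Homogeneity and the triangle inequality follow from linearity of the stress and the jumps, since the
norm is a Euclidean combination of finitely many seminorms. -/

noncomputable section

namespace BrokenSobolev

variable {d : ℕ}

open Metric Convolution ContinuousLinearMap

/-! ### Mollification and weak derivatives -/

/-- Mollification of a scalar function by a normalised bump function. -/
def mollify (φ : ContDiffBump (0 : Space d)) (f : Space d → ℝ) : Space d → ℝ :=
  φ.normed volume ⋆[lsmul ℝ ℝ, volume] f

lemma mollify_apply (φ : ContDiffBump (0 : Space d)) (f : Space d → ℝ) (z : Space d) :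
    mollify φ f z = ∫ y, φ.normed volume (z - y) * f y := by
  rw [mollify, convolution_eq_swap]
  rfl

lemma contDiff_mollify (φ : ContDiffBump (0 : Space d)) {f : Space d → ℝ}
    (hf : LocallyIntegrable f) : ContDiff ℝ ∞ (mollify φ f) :=
  φ.hasCompactSupport_normed.contDiff_convolution_left _ φ.contDiff_normed hf

lemma hasFDerivAt_mollify (φ : ContDiffBump (0 : Space d)) {f : Space d → ℝ}
    (hf : LocallyIntegrable f) (z v : Space d) :
    fderiv ℝ (mollify φ f) z v = ∫ y, fderiv ℝ (φ.normed volume) (z - y) v * f y := by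
  have h := (φ.hasCompactSupport_normed (μ := volume)).hasFDerivAt_convolution_left (μ := volume)
    (lsmul ℝ ℝ)
    (φ.contDiff_normed (n := 1)) hf z
  rw [mollify, h.fderiv, convolution_eq_swap]
  have hc : HasCompactSupport (fderiv ℝ (φ.normed (volume : Measure (Space d)))) :=
    φ.hasCompactSupport_normed.fderiv ℝ
  have hcont : Continuous (fderiv ℝ (φ.normed (volume : Measure (Space d)))) :=
    (φ.contDiff_normed (n := 1)).continuous_fderiv (by simp)
  have hInt := hc.convolutionExists_left ((lsmul ℝ ℝ : ℝ →L[ℝ] ℝ →L[ℝ] ℝ).precompL (Space d))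
    hcont hf z
  have hInt' := hInt.integrable_swap
  rw [ContinuousLinearMap.integral_apply hInt']
  rfl

/-- The derivative of a mollification is the mollification of the weak derivative. -/
lemma HasWeakPartial.fderiv_mollify {U : Set (Space d)} (hU : MeasurableSet U) {f g : Space d → ℝ}
    {j : Fin d} (h : HasWeakPartial U f j g) (hf : LocallyIntegrable (U.indicator f))
    (φ : ContDiffBump (0 : Space d)) {z : Space d} (hz : closedBall z φ.rOut ⊆ U) :
    fderiv ℝ (mollify φ (U.indicator f)) z (EuclideanSpace.single j 1) =
      mollify φ (U.indicator g) z := by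
  have hd : ContDiff ℝ ∞ (φ.normed (volume : Measure (Space d))) := φ.contDiff_normed
  have hs : ContDiff ℝ ∞ fun y : Space d => φ.normed volume (z - y) :=
    hd.comp (contDiff_const.sub contDiff_id)
  -- The reflected, translated kernel is an admissible test function: its support stays in the ball
  -- assumed to lie in `U`.
  have hts : tsupport (fun y : Space d => φ.normed volume (z - y)) ⊆ closedBall z φ.rOut := by
    refine closure_minimal (fun y hy => ?_) isClosed_closedBall
    have : z - y ∈ Function.support (φ.normed (volume : Measure (Space d))) := hy
    rw [φ.support_normed_eq, mem_ball, dist_zero_right] at this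
    rw [mem_closedBall, dist_comm, dist_eq_norm]
    exact this.le
  have hcs : HasCompactSupport fun y : Space d => φ.normed volume (z - y) :=
    (isCompact_closedBall z φ.rOut).of_isClosed_subset (isClosed_tsupport _) hts
  have key := h _ hs hcs (hts.trans hz)
  -- The sign from differentiating `z - y` cancels the sign in the definition of the weak
  -- derivative.
  have hfd : ∀ y, fderiv ℝ (fun y : Space d => φ.normed volume (z - y)) y
      (EuclideanSpace.single j 1) =
        - fderiv ℝ (φ.normed volume) (z - y) (EuclideanSpace.single j 1) := by
    intro y
    have h1 : HasFDerivAt (fun y : Space d => z - y) (-ContinuousLinearMap.id ℝ (Space d)) y := by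
      simpa using (hasFDerivAt_id y).const_sub z
    have h2 := ((hd.differentiable (by simp)) (z - y)).hasFDerivAt.comp y h1
    have h3 : (φ.normed (volume : Measure (Space d))) ∘ (fun y : Space d => z - y) =
      fun y : Space d => φ.normed volume (z - y) := rfl
    rw [← h3, h2.fderiv]
    simp
  rw [hasFDerivAt_mollify φ hf, mollify_apply]
  simp only [hfd] at key
  have e1 : ∀ (a b : Space d → ℝ), ∫ y, a y * U.indicator b y = ∫ y in U, b y * a y := by
    intro a b
    rw [← integral_indicator hU]
    congr 1
    ext y
    by_cases hy : y ∈ U <;> simp [hy, mul_comm]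
  rw [e1, e1]
  simp only [mul_neg, integral_neg] at key
  linarith

lemma hasCompactSupport_mollify (φ : ContDiffBump (0 : Space d)) {f : Space d → ℝ}
    (hf : HasCompactSupport f) : HasCompactSupport (mollify φ f) :=
  φ.hasCompactSupport_normed.convolution _ hf

/-! ### Rigidity of compactly supported fields with vanishing stress -/

/-- The gradient of a compactly supported smooth field satisfies
`∫ ∂_j u_i ∂_i u_j = ∫ ∂_i u_i ∂_j u_j`. -/
lemma integral_fderiv_mul_fderiv_comm {u v : Space d → ℝ} (hu : ContDiff ℝ ∞ u)
    (hv : ContDiff ℝ ∞ v) (hcu : HasCompactSupport u)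
    (a b : Space d) :
    ∫ x, fderiv ℝ u x a * fderiv ℝ v x b = ∫ x, fderiv ℝ u x b * fderiv ℝ v x a := by
  have hD : ∀ {w : Space d → ℝ}, ContDiff ℝ ∞ w → ∀ c, ContDiff ℝ ∞ fun x => fderiv ℝ w x c :=
    fun hw c => (hw.fderiv_right (m := ∞) (by simp)).clm_apply contDiff_const
  have hDc : ∀ {w : Space d → ℝ}, HasCompactSupport w → ∀ c,
      HasCompactSupport fun x => fderiv ℝ w x c := fun hw c => hw.fderiv_apply (𝕜 := ℝ) c
  have hdiff : ∀ {w : Space d → ℝ}, ContDiff ℝ ∞ w → ∀ x, DifferentiableAt ℝ w x :=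
    fun hw x => (hw.differentiable (by simp)) x
  have hInt : ∀ {w z : Space d → ℝ}, ContDiff ℝ ∞ w → ContDiff ℝ ∞ z → HasCompactSupport w →
      Integrable (fun x => w x * z x) := fun hw hz hc =>
    (hw.continuous.mul hz.continuous).integrable_of_hasCompactSupport hc.mul_right
  -- Moving the derivative off `u` produces a second derivative of `v`, which is symmetric in the
  -- two directions.
  have key : ∀ a b : Space d, ∫ x, u x * fderiv ℝ (fun y => fderiv ℝ v y b) x a =
      - ∫ x, fderiv ℝ u x a * fderiv ℝ v x b := fun a b =>
    integral_mul_fderiv_eq_neg_fderiv_mul_of_integrable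
      (hInt (hD hu a) (hD hv b) (hDc hcu a)) (hInt hu (hD (hD hv b) a) hcu)
      (hInt hu (hD hv b) hcu) (fun x _ => hdiff hu x) (fun x _ => hdiff (hD hv b) x)
  have hsymm : ∀ x, fderiv ℝ (fun y => fderiv ℝ v y b) x a =
      fderiv ℝ (fun y => fderiv ℝ v y a) x b := by
    intro x
    have h2 : DifferentiableAt ℝ (fderiv ℝ v) x :=
      ((hv.fderiv_right (m := ∞) (by simp)).differentiable (by simp)) x
    have e : ∀ c e : Space d, fderiv ℝ (fun y => fderiv ℝ v y c) x e =
        fderiv ℝ (fderiv ℝ v) x e c := by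
      intro c e
      rw [fderiv_clm_apply h2 (by fun_prop)]
      simp
    rw [e, e]
    exact (hv.contDiffAt.isSymmSndFDerivAt
      (by simpa using WithTop.coe_le_coe.2 (le_top : (2 : ℕ∞) ≤ ⊤))).eq a b
  have h1 := key a b
  have h2 := key b a
  simp only [hsymm] at h1
  linarith

lemma integrable_mollify (φ : ContDiffBump (0 : Space d)) {f : Space d → ℝ}
    (hf : LocallyIntegrable f) (z : Space d) :
    Integrable fun y => φ.normed volume (z - y) * f y :=
  ((φ.hasCompactSupport_normed (μ := volume)).convolutionExists_left (lsmul ℝ ℝ)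
    φ.continuous_normed hf z).integrable_swap

/-- A compactly supported field on the whole space whose weak gradient `g` satisfies
`g + gᵀ = (2/3) (tr g) I` vanishes almost everywhere. -/
lemma ae_eq_zero_of_weakPartial_symm {W : Fin d → Space d → ℝ} {g : Fin d → Fin d → Space d → ℝ}
    (hd : 0 < d) (hW : ∀ i, LocallyIntegrable (W i)) (hWc : ∀ i, HasCompactSupport (W i))
    (hg : ∀ i j, LocallyIntegrable (g i j))
    (hwp : ∀ i j, HasWeakPartial Set.univ (W i) j (g i j))
    (hs : ∀ i j, ∀ᵐ x, g i j x + g j i x = if i = j then (2 / 3) * ∑ k, g k k x else 0) (i : Fin d) :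
    W i =ᵐ[volume] 0 := by
  have main : ∀ φ : ContDiffBump (0 : Space d), mollify φ (W i) = 0 := by
    intro φ
    have hu : ∀ i, ContDiff ℝ ∞ (mollify φ (W i)) := fun i => contDiff_mollify φ (hW i)
    have hc : ∀ i, HasCompactSupport (mollify φ (W i)) := fun i =>
      hasCompactSupport_mollify φ (hWc i)
    set G : Fin d → Fin d → Space d → ℝ :=
      fun i j x => fderiv ℝ (mollify φ (W i)) x (EuclideanSpace.single j 1) with hG
    have hGm : ∀ i j x, G i j x = mollify φ (g i j) x := by
      intro i j x
      have := (hwp i j).fderiv_mollify MeasurableSet.univ (by simpa using hW i) φ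
        (z := x) (Set.subset_univ _)
      simpa [hG] using this
    -- The relation between the weak derivatives is linear with constant coefficients, so it
    -- survives mollification and then holds at every point.
    have hrel : ∀ i j x, G i j x + G j i x = if i = j then (2 / 3) * ∑ k, G k k x else 0 := by
      intro i j x
      simp only [hGm, mollify_apply]
      rw [← integral_add (integrable_mollify φ (hg i j) x) (integrable_mollify φ (hg j i) x),
        ← integral_finsetSum _ (fun k _ => integrable_mollify φ (hg k k) x)]
      have e : ∫ y, (φ.normed volume (x - y) * g i j y + φ.normed volume (x - y) * g j i y) =
          ∫ y, if i = j then (2 / 3) * ∑ k, φ.normed volume (x - y) * g k k y else 0 := by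
        refine integral_congr_ae ?_
        filter_upwards [hs i j] with y hy
        rw [← mul_add, hy, ← Finset.mul_sum]
        split_ifs <;> ring
      rw [e]
      split_ifs
      · rw [integral_const_mul]
      · simp
    have hGc : ∀ i j, Continuous (G i j) := fun i j =>
      ((hu i).continuous_fderiv (by simp)).clm_apply continuous_const
    have hGs : ∀ i j, HasCompactSupport (G i j) := fun i j => (hc i).fderiv_apply (𝕜 := ℝ) _
    have hInt : ∀ i j k l, Integrable fun x => G i j x * G k l x := fun i j k l =>
      ((hGc i j).mul (hGc k l)).integrable_of_hasCompactSupport (hGs i j).mul_right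
    have hcomm : ∀ i j, ∫ x, G i j x * G j i x = ∫ x, G i i x * G j j x := fun i j =>
      integral_fderiv_mul_fderiv_comm (hu i) (hu j) (hc i) _ _
    -- The relation contracted with `G`: the right side sees only the diagonal and becomes `(2/3)(tr
    -- G)²`.
    have hpt : ∀ x, ∑ i, ∑ j, G i j x * G i j x + ∑ i, ∑ j, G i j x * G j i x =
        (2 / 3) * ∑ i, ∑ j, G i i x * G j j x := by
      intro x
      simp only [← Finset.sum_add_distrib, ← mul_add, hrel]
      simp only [mul_ite, mul_zero, Finset.sum_ite_eq, Finset.mem_univ, if_true]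
      simp only [Finset.mul_sum]
      exact Finset.sum_congr rfl fun i _ => Finset.sum_congr rfl fun j _ => by ring
    -- By `hcomm` the mixed term integrates to `∫ (tr G)²`, and `2/3 - 1 = -1/3`.
    have hI : ∫ x, ∑ i, ∑ j, G i j x * G i j x = -(1 / 3) * ∫ x, (∑ i, G i i x) ^ 2 := by
      have e1 : ∫ x, ∑ i, ∑ j, G i j x * G j i x = ∫ x, ∑ i, ∑ j, G i i x * G j j x := by
        rw [integral_finsetSum _ fun i _ => integrable_finsetSum Finset.univ fun j _ => hInt _ _ _ _,
          integral_finsetSum _ fun i _ => integrable_finsetSum Finset.univ fun j _ => hInt _ _ _ _]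
        refine Finset.sum_congr rfl fun i _ => ?_
        rw [integral_finsetSum _ fun j _ => hInt _ _ _ _,
          integral_finsetSum _ fun j _ => hInt _ _ _ _]
        exact Finset.sum_congr rfl fun j _ => hcomm i j
      have e2 := integral_congr_ae (μ := (volume : Measure (Space d))) (ae_of_all _ hpt)
      rw [integral_add (integrable_finsetSum _ fun i _ => integrable_finsetSum _ fun j _ =>
        hInt _ _ _ _) (integrable_finsetSum _ fun i _ => integrable_finsetSum _ fun j _ =>
        hInt _ _ _ _), integral_const_mul, e1] at e2
      have e3 : ∀ x, (∑ i, G i i x) ^ 2 = ∑ i, ∑ j, G i i x * G j j x := fun x => by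
        rw [sq, Finset.sum_mul_sum]
      simp only [e3]
      linarith
    have hnn : ∀ x, 0 ≤ ∑ i, ∑ j, G i j x * G i j x := fun x =>
      Finset.sum_nonneg fun i _ => Finset.sum_nonneg fun j _ => mul_self_nonneg _
    have h0 : ∫ x, ∑ i, ∑ j, G i j x * G i j x = 0 := by
      refine le_antisymm ?_ (integral_nonneg hnn)
      rw [hI]
      have : 0 ≤ ∫ x, (∑ i, G i i x) ^ 2 := integral_nonneg fun x => sq_nonneg _
      linarith
    have hGz : ∀ i j x, G i j x = 0 := by
      have hz := (integral_eq_zero_iff_of_nonneg hnn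
        (integrable_finsetSum _ fun i _ => integrable_finsetSum _ fun j _ => hInt _ _ _ _)).1 h0
      have hcont : Continuous fun x => ∑ i, ∑ j, G i j x * G i j x := by fun_prop
      have hz' := (hcont.ae_eq_iff_eq volume continuous_zero).1 hz
      intro i j x
      have h1 := congrFun hz' x
      simp only [Pi.zero_apply] at h1
      rw [Finset.sum_eq_zero_iff_of_nonneg
        (fun i _ => Finset.sum_nonneg fun j _ => mul_self_nonneg _)] at h1
      have h2 := h1 i (Finset.mem_univ _)
      rw [Finset.sum_eq_zero_iff_of_nonneg (fun j _ => mul_self_nonneg _)] at h2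
      exact mul_self_eq_zero.1 (h2 j (Finset.mem_univ _))
    have hfd : ∀ x, fderiv ℝ (mollify φ (W i)) x = 0 := by
      intro x
      ext v
      rw [← (EuclideanSpace.basisFun (Fin d) ℝ).sum_repr v]
      simp only [map_sum, map_smul, zero_apply, smul_zero, Finset.sum_const_zero]
      refine Finset.sum_eq_zero fun j _ => ?_
      have := hGz i j x
      simp only [hG] at this
      simp [this]
    have hconst : ∀ x y, mollify φ (W i) x = mollify φ (W i) y :=
      is_const_of_fderiv_eq_zero ((hu i).differentiable (by simp)) hfd
    -- For `d > 0` the space is not compact, so the support misses some point `x0`, where the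
    -- constant is read off.
    have : Nonempty (Fin d) := ⟨⟨0, hd⟩⟩
    have : NoncompactSpace (Space d) := NormedSpace.noncompactSpace ℝ (Space d)
    obtain ⟨x0, hx0⟩ : ∃ x, x ∉ tsupport (mollify φ (W i)) := by
      by_contra! hall
      exact (hc i).ne_univ (Set.eq_univ_of_forall hall)
    funext x
    rw [hconst x x0, image_eq_zero_of_notMem_tsupport hx0]
    rfl
  -- The outer radius is twice the inner one; a bounded ratio is what almost everywhere convergence
  -- of the mollifications requires.
  let φ : ℕ → ContDiffBump (0 : Space d) := fun n =>
    ⟨1 / (2 * ((n : ℝ) + 1)), 1 / ((n : ℝ) + 1), by positivity, by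
      apply one_div_lt_one_div_of_lt <;> [positivity; linarith [(n.cast_nonneg : (0 : ℝ) ≤ n)]]⟩
  have hlim := ContDiffBump.ae_convolution_tendsto_right_of_locallyIntegrable (φ := φ) (l := atTop)
    (K := 2) (μ := volume) tendsto_one_div_add_atTop_nhds_zero_nat
    (Eventually.of_forall fun n => by
      simp only [φ]
      have : (0 : ℝ) < (n : ℝ) + 1 := by positivity
      field_simp
      rfl) (hW i)
  filter_upwards [hlim] with x hx
  have : ∀ n, ((φ n).normed volume ⋆[lsmul ℝ ℝ, volume] W i) x = 0 := fun n =>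
    congrFun (main (φ n)) x
  simp only [this] at hx
  exact (tendsto_nhds_unique hx tendsto_const_nhds)

/-! ### Approximation in `L²` and density of smooth functions in `H¹` -/

lemma eLpNorm_two_eq {α E : Type*} [MeasurableSpace α] [NormedAddCommGroup E] (μ : Measure α)
    (f : α → E) : eLpNorm f 2 μ = (∫⁻ x, ‖f x‖ₑ ^ 2 ∂μ) ^ (1 / 2 : ℝ) := by
  rw [eLpNorm_eq_lintegral_rpow_enorm_toReal (by norm_num) (by norm_num)]
  simp

lemma eLpNorm_two_sq {α E : Type*} [MeasurableSpace α] [NormedAddCommGroup E] (μ : Measure α)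
    (f : α → E) : eLpNorm f 2 μ ^ 2 = ∫⁻ x, ‖f x‖ₑ ^ 2 ∂μ := by
  rw [eLpNorm_two_eq, ← ENNReal.rpow_natCast, ← ENNReal.rpow_mul]
  simp

/-- Dominated convergence in `L²`. -/
lemma tendsto_eLpNorm_two_of_dominated {α E : Type*} [MeasurableSpace α] [NormedAddCommGroup E]
    {μ : Measure α} {F : ℕ → α → E} {b : α → ℝ} (hF : ∀ n, AEStronglyMeasurable (F n) μ)
    (hb : MemLp b 2 μ) (hFb : ∀ n, ∀ᵐ x ∂μ, ‖F n x‖ ≤ b x)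
    (hlim : ∀ᵐ x ∂μ, Tendsto (fun n => F n x) atTop (𝓝 0)) :
    Tendsto (fun n => eLpNorm (F n) 2 μ) atTop (𝓝 0) := by
  have h1 : Tendsto (fun n => ∫⁻ x, ‖F n x‖ₑ ^ 2 ∂μ) atTop (𝓝 (∫⁻ _, 0 ∂μ)) := by
    refine tendsto_lintegral_of_dominated_convergence' (fun x => ‖b x‖ₑ ^ 2)
      (fun n => (hF n).enorm.pow_const 2) (fun n => ?_) ?_ ?_
    · filter_upwards [hFb n] with x hx
      gcongr
      exact enorm_le_iff_norm_le.2 (hx.trans (le_abs_self _))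
    · rw [← eLpNorm_two_sq]
      exact (ENNReal.pow_lt_top hb.2).ne
    · filter_upwards [hlim] with x hx
      have := (ENNReal.continuous_pow 2).tendsto _ |>.comp hx.enorm
      simpa [Function.comp_def] using this
  simp only [eLpNorm_two_eq]
  have h2 := (ENNReal.continuous_rpow_const (y := (1 / 2 : ℝ))).tendsto _ |>.comp h1
  simpa [Function.comp_def] using h2

/-- The kernel centred at `z` is the density of a probability measure, on which the `L¹` norm is at
most the `L²` norm. -/
lemma mollify_enorm_sq_le (φ : ContDiffBump (0 : Space d)) {f : Space d → ℝ}
    (hf : AEStronglyMeasurable f volume) (z : Space d) :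
    ‖mollify φ f z‖ₑ ^ 2 ≤ ∫⁻ y, ENNReal.ofReal (φ.normed volume (z - y)) * ‖f y‖ₑ ^ 2 := by
  set ρ : Space d → ℝ≥0∞ := fun y => ENNReal.ofReal (φ.normed volume (z - y)) with hρ
  have hm : Measurable ρ :=
    (φ.continuous_normed.comp (continuous_const.sub continuous_id)).measurable.ennreal_ofReal
  set ν : Measure (Space d) := volume.withDensity ρ with hν
  have hprob : IsProbabilityMeasure ν := by
    constructor
    rw [hν, withDensity_apply _ MeasurableSet.univ, Measure.restrict_univ, hρ,
      ← ofReal_integral_eq_lintegral_ofReal, integral_sub_left_eq_self, φ.integral_normed]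
    · simp
    · exact φ.integrable_normed.comp_sub_left z
    · exact ae_of_all _ fun y => φ.nonneg_normed _
  have hfν : AEStronglyMeasurable f ν := hf.mono_ac (withDensity_absolutelyContinuous _ _)
  have e : ∀ g : Space d → ℝ≥0∞, ∫⁻ y, g y ∂ν = ∫⁻ y, ρ y * g y := fun g => by
    rw [hν, lintegral_withDensity_eq_lintegral_mul_non_measurable _ hm
      (ae_of_all _ fun y => ENNReal.ofReal_lt_top)]
    rfl
  have h1 : ‖mollify φ f z‖ₑ ≤ eLpNorm f 1 ν := by
    rw [mollify_apply, eLpNorm_one_eq_lintegral_enorm, e]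
    refine (enorm_integral_le_lintegral_enorm _).trans (lintegral_mono fun y => ?_)
    rw [enorm_mul, hρ, Real.enorm_eq_ofReal (φ.nonneg_normed _)]
  have h2 := h1.trans (eLpNorm_le_eLpNorm_of_exponent_le (p := 1) (q := 2) (by norm_num) hfν)
  calc _ ≤ eLpNorm f 2 ν ^ 2 := by gcongr
    _ = _ := by rw [eLpNorm_two_sq, e]

lemma lintegral_normed_sub (φ : ContDiffBump (0 : Space d)) (y : Space d) :
    ∫⁻ z, ENNReal.ofReal (φ.normed volume (z - y)) = 1 := by
  rw [← ofReal_integral_eq_lintegral_ofReal (φ.integrable_normed.comp_sub_right y)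
    (ae_of_all _ fun z => φ.nonneg_normed _), integral_sub_right_eq_self, φ.integral_normed,
    ENNReal.ofReal_one]

/-- Young's inequality for mollifications in `L²`. -/
lemma eLpNorm_mollify_le (φ : ContDiffBump (0 : Space d)) {f : Space d → ℝ}
    (hf : AEStronglyMeasurable f volume) :
    eLpNorm (mollify φ f) 2 volume ≤ eLpNorm f 2 volume := by
  rw [eLpNorm_two_eq, eLpNorm_two_eq]
  refine ENNReal.rpow_le_rpow ?_ (by norm_num)
  have hmρ : Measurable fun p : Space d × Space d =>
      ENNReal.ofReal (φ.normed volume (p.1 - p.2)) :=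
    (φ.continuous_normed.comp (continuous_fst.sub continuous_snd)).measurable.ennreal_ofReal
  have hm : AEMeasurable (Function.uncurry fun z y : Space d =>
      ENNReal.ofReal (φ.normed volume (z - y)) * ‖f y‖ₑ ^ 2) (volume.prod volume) :=
    hmρ.aemeasurable.mul ((hf.enorm.comp_snd).pow_const 2)
  have hmy : ∀ y : Space d, Measurable fun z : Space d =>
      ENNReal.ofReal (φ.normed volume (z - y)) := fun y =>
    (φ.continuous_normed.comp (continuous_id.sub continuous_const)).measurable.ennreal_ofReal
  refine (lintegral_mono fun z => mollify_enorm_sq_le φ hf z).trans ?_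
  rw [lintegral_lintegral_swap hm]
  refine lintegral_mono fun y => ?_
  rw [lintegral_mul_const _ (hmy y), lintegral_normed_sub, one_mul]

/-- The homothety with centre `c` and ratio `t`. -/
def dilate (c : Space d) (t : ℝ) (x : Space d) : Space d := c + t • (x - c)

lemma continuous_dilate (c : Space d) (t : ℝ) : Continuous (dilate c t) := by
  unfold dilate; fun_prop

lemma map_dilate (c : Space d) {t : ℝ} (ht : t ≠ 0) :
    (volume : Measure (Space d)).map (dilate c t) = ENNReal.ofReal |(t ^ d)⁻¹| • volume := by
  have h : dilate c t = (fun x => x + (c - t • c)) ∘ (t • ·) := by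
    funext x
    simp only [dilate, Function.comp, smul_sub]
    abel
  rw [h, ← Measure.map_map (by fun_prop) (by fun_prop), Measure.map_addHaar_smul _ ht,
    Measure.map_smul, map_add_right_eq_self]
  simp

/-- The change of variables costs `t^(-d/2)`. The cruder factor `2 ^ d` suffices, since only
uniformity in `t ≥ 1/2` matters. -/
lemma eLpNorm_comp_dilate_le (c : Space d) {t : ℝ} (ht : 1 / 2 ≤ t) {f : Space d → ℝ}
    (hf : AEStronglyMeasurable f volume) :
    eLpNorm (f ∘ dilate c t) 2 volume ≤ ENNReal.ofReal (2 ^ d) * eLpNorm f 2 volume := by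
  have ht0 : 0 < t := by linarith
  have hf' : AEStronglyMeasurable f (volume.map (dilate c t)) := by
    rw [map_dilate c ht0.ne']
    exact hf.smul_measure _
  rw [← eLpNorm_map_measure hf' (continuous_dilate c t).measurable.aemeasurable,
    map_dilate c ht0.ne', eLpNorm_smul_measure_of_ne_top (by norm_num), smul_eq_mul]
  gcongr
  have h1 : |(t ^ d)⁻¹| ≤ 2 ^ d := by
    rw [abs_of_pos (by positivity), ← inv_pow]
    gcongr
    rw [inv_le_comm₀ ht0 (by norm_num)]
    linarith
  have h2 : (1 : ℝ≥0∞) ≤ ENNReal.ofReal (2 ^ d) := by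
    rw [ENNReal.one_le_ofReal]
    exact one_le_pow₀ (by norm_num)
  calc ENNReal.ofReal |(t ^ d)⁻¹| ^ (1 / (2 : ℝ≥0∞)).toReal
      ≤ ENNReal.ofReal (2 ^ d) ^ (1 / (2 : ℝ≥0∞)).toReal := by gcongr
    _ ≤ ENNReal.ofReal (2 ^ d) ^ (1 : ℝ) := ENNReal.rpow_le_rpow_of_exponent_le h2 (by norm_num)
    _ = _ := by simp

/-- Dominated convergence: the functions converge pointwise, are bounded by `2 M`, and vanish
outside one fixed ball. -/
lemma tendsto_mollify_dilate_of_continuous {g : Space d → ℝ} (hg : Continuous g)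
    (hgc : HasCompactSupport g) (c : Space d) {φ : ℕ → ContDiffBump (0 : Space d)}
    (hφ : Tendsto (fun n => (φ n).rOut) atTop (𝓝 0)) (hφ1 : ∀ n, (φ n).rOut ≤ 1) {t : ℕ → ℝ}
    (ht : Tendsto t atTop (𝓝 1)) (ht2 : ∀ n, 1 / 2 ≤ t n) :
    Tendsto (fun n => eLpNorm (fun x => mollify (φ n) g (dilate c (t n) x) - g x) 2 volume)
      atTop (𝓝 0) := by
  obtain ⟨M, hM⟩ := hg.bounded_above_of_compact_support hgc
  have hM0 : 0 ≤ M := (norm_nonneg _).trans (hM 0)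
  obtain ⟨R, hR⟩ := hgc.isBounded.subset_closedBall c
  -- Beyond distance `R'` from `c`, a dilation of ratio at least `1/2` leaves the point farther than
  -- `max R 0 + 1`, so a kernel of radius at most `1` does not reach the support of `g`.
  set R' := 2 * (max R 0 + 1) with hR'
  have hsupp : ∀ y, y ∉ closedBall c (max R 0) → g y = 0 := fun y hy =>
    image_eq_zero_of_notMem_tsupport fun h => hy (closedBall_subset_closedBall (le_max_left _ _) (hR h))
  have hcont : ∀ n, Continuous fun x => mollify (φ n) g (dilate c (t n) x) := fun n =>
    (contDiff_mollify (φ n) hg.locallyIntegrable).continuous.comp (continuous_dilate c _)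
  refine tendsto_eLpNorm_two_of_dominated (b := (closedBall c R').indicator fun _ => 2 * M)
    (fun n => ((hcont n).sub hg).aestronglyMeasurable) ?_ (fun n => ae_of_all _ fun x => ?_)
    (ae_of_all _ fun x => ?_)
  · exact memLp_indicator_const _ isClosed_closedBall.measurableSet _
      (Or.inr (isCompact_closedBall _ _).measure_lt_top.ne)
  · have hmoll : ∀ z, ‖mollify (φ n) g z‖ ≤ M := by
      intro z
      rw [mollify_apply]
      calc ‖∫ y, (φ n).normed volume (z - y) * g y‖
          ≤ ∫ y, (φ n).normed volume (z - y) * M := by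
            refine norm_integral_le_of_norm_le
              (((φ n).integrable_normed.comp_sub_left z).mul_const M) (ae_of_all _ fun y => ?_)
            rw [norm_mul, Real.norm_of_nonneg ((φ n).nonneg_normed _)]
            exact mul_le_mul_of_nonneg_left (hM y) ((φ n).nonneg_normed _)
        _ = M := by
            rw [integral_mul_const, integral_sub_left_eq_self, (φ n).integral_normed, one_mul]
    by_cases hx : x ∈ closedBall c R'
    · rw [Set.indicator_of_mem hx]
      calc _ ≤ ‖mollify (φ n) g (dilate c (t n) x)‖ + ‖g x‖ := norm_sub_le _ _
        _ ≤ 2 * M := by linarith [hmoll (dilate c (t n) x), hM x]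
    · rw [Set.indicator_of_notMem hx]
      rw [mem_closedBall, dist_eq_norm, not_le] at hx
      have hmax : 0 ≤ max R 0 := le_max_right _ _
      have h1 : g x = 0 := hsupp x (by
        rw [mem_closedBall, dist_eq_norm, not_le]; linarith)
      have h2 : mollify (φ n) g (dilate c (t n) x) = 0 := by
        rw [mollify_apply]
        refine integral_eq_zero_of_ae (ae_of_all _ fun y => ?_)
        by_cases hy : y ∈ closedBall c (max R 0)
        · have : dilate c (t n) x - y ∉ Function.support ((φ n).normed (volume : Measure (Space d))) := by
            rw [(φ n).support_normed_eq, mem_ball, dist_zero_right, not_lt]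
            rw [mem_closedBall, dist_eq_norm] at hy
            have e : t n • (x - c) = (dilate c (t n) x - y) + (y - c) := by
              simp only [dilate]; abel
            have h3 : ‖t n • (x - c)‖ ≤ ‖dilate c (t n) x - y‖ + ‖y - c‖ := by
              rw [e]; exact norm_add_le _ _
            rw [norm_smul, Real.norm_of_nonneg (by linarith [ht2 n])] at h3
            have h4 : 1 / 2 * ‖x - c‖ ≤ t n * ‖x - c‖ :=
              mul_le_mul_of_nonneg_right (ht2 n) (norm_nonneg _)
            linarith [hφ1 n]
          rw [Function.notMem_support] at this
          simp [this]
        · simp [hsupp y hy]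
      simp [h1, h2]
  · have hk : Tendsto (fun n => dilate c (t n) x) atTop (𝓝 x) := by
      have : Tendsto (fun n => c + t n • (x - c)) atTop (𝓝 (c + (1 : ℝ) • (x - c))) :=
        tendsto_const_nhds.add (ht.smul_const _)
      simpa [dilate] using this
    have h := ContDiffBump.convolution_tendsto_right (μ := volume) (g := fun _ : ℕ => g)
      (z₀ := g x) hφ (Eventually.of_forall fun _ => hg.aestronglyMeasurable)
      ((hg.tendsto x).comp tendsto_snd) hk
    have := h.sub_const (g x)
    rw [sub_self] at this
    exact this

/-- Mollifications composed with dilations converge in `L²`. -/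
lemma tendsto_mollify_dilate {f : Space d → ℝ} (hf : MemLp f 2 volume) (c : Space d)
    {φ : ℕ → ContDiffBump (0 : Space d)}
    (hφ : Tendsto (fun n => (φ n).rOut) atTop (𝓝 0)) (hφ1 : ∀ n, (φ n).rOut ≤ 1) {t : ℕ → ℝ}
    (ht : Tendsto t atTop (𝓝 1)) (ht2 : ∀ n, 1 / 2 ≤ t n) :
    Tendsto (fun n => eLpNorm (fun x => mollify (φ n) f (dilate c (t n) x) - f x) 2 volume)
      atTop (𝓝 0) := by
  -- Replacing `f` by a continuous `g` leaves three errors: `2 ^ d` bounds the mollified and dilated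
  -- `f - g`, and the `2` counts the error for `g` and `f - g` itself.
  set C : ℝ≥0∞ := ENNReal.ofReal (2 ^ d) + 2 with hC
  have hCtop : C ≠ ⊤ := by simp [hC]
  have hC0 : C ≠ 0 := by simp [hC]
  rw [ENNReal.tendsto_nhds_zero]
  intro ε hε
  obtain ⟨g, hgc, hfg, hg, hg2⟩ := hf.exists_hasCompactSupport_eLpNorm_sub_le (by norm_num)
    (ENNReal.div_pos hε.ne' hCtop).ne'
  have hlim := tendsto_mollify_dilate_of_continuous hg hgc c hφ hφ1 ht ht2
  have hεC : 0 < ε / C := ENNReal.div_pos hε.ne' hCtop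
  filter_upwards [(ENNReal.tendsto_nhds_zero.1 hlim) _ hεC] with n hn
  have hfl := hf.locallyIntegrable (by norm_num)
  have hgl : LocallyIntegrable g := hg.locallyIntegrable
  have hsubl : LocallyIntegrable (f - g) := hfl.sub hgl
  have hmc : Continuous (mollify (φ n) (f - g)) := (contDiff_mollify (φ n) hsubl).continuous
  have e : (fun x => mollify (φ n) f (dilate c (t n) x) - f x) =
      (mollify (φ n) (f - g) ∘ dilate c (t n)) +
        ((fun x => mollify (φ n) g (dilate c (t n) x) - g x) - (f - g)) := by
    funext x
    have h1 : mollify (φ n) (f - g) (dilate c (t n) x) =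
        mollify (φ n) f (dilate c (t n) x) - mollify (φ n) g (dilate c (t n) x) := by
      rw [mollify_apply, mollify_apply, mollify_apply,
        ← integral_sub (integrable_mollify _ hfl _) (integrable_mollify _ hgl _)]
      congr 1
      funext y
      simp only [Pi.sub_apply]
      ring
    simp only [Pi.add_apply, Pi.sub_apply, Function.comp_apply, h1]
    ring
  have hm1 : AEStronglyMeasurable (mollify (φ n) (f - g) ∘ dilate c (t n)) volume :=
    (hmc.comp (continuous_dilate c _)).aestronglyMeasurable
  have hm2 : AEStronglyMeasurable (fun x => mollify (φ n) g (dilate c (t n) x) - g x) volume :=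
    (((contDiff_mollify (φ n) hgl).continuous.comp (continuous_dilate c _)).sub
      hg).aestronglyMeasurable
  have hm3 : AEStronglyMeasurable (f - g) volume := hf.1.sub hg.aestronglyMeasurable
  rw [e]
  calc _ ≤ eLpNorm (mollify (φ n) (f - g) ∘ dilate c (t n)) 2 volume +
        (eLpNorm (fun x => mollify (φ n) g (dilate c (t n) x) - g x) 2 volume +
          eLpNorm (f - g) 2 volume) :=
        (eLpNorm_add_le hm1 (hm2.sub hm3) (by norm_num)).trans
          (add_le_add_right (eLpNorm_sub_le hm2 hm3 (by norm_num)) _)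
    _ ≤ ENNReal.ofReal (2 ^ d) * (ε / C) + (ε / C + ε / C) := by
        gcongr
        refine (eLpNorm_comp_dilate_le c (ht2 n) hmc.aestronglyMeasurable).trans ?_
        gcongr
        exact (eLpNorm_mollify_le (φ n) hm3).trans hfg
    _ = C * (ε / C) := by rw [hC]; ring
    _ = ε := ENNReal.mul_div_cancel hC0 hCtop

/-- On a bounded convex open set, functions that are smooth up to the boundary are dense
in `H¹`. -/
lemma MemH1.exists_smooth_approx {K : Set (Space d)} (hc : Convex ℝ K) (ho : IsOpen K)
    (hb : Bornology.IsBounded K) {f : Space d → ℝ} (hf : MemH1 K f) :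
    ∃ u : ℕ → Space d → ℝ, (∀ n, ContDiff ℝ ∞ (u n)) ∧
      Tendsto (fun n => eLpNorm (fun x => u n x - f x) 2 (volume.restrict K)) atTop (𝓝 0) ∧
      ∀ j, Tendsto (fun n => eLpNorm (fun x => fderiv ℝ (u n) x (EuclideanSpace.single j 1) -
        weakPartial K f j x) 2 (volume.restrict K)) atTop (𝓝 0) := by
  rcases K.eq_empty_or_nonempty with rfl | ⟨c, hcK⟩
  · exact ⟨fun _ _ => 0, fun _ => contDiff_const, by simp, by simp⟩
  obtain ⟨r₀, hr₀, hball₀⟩ := Metric.isOpen_iff.1 ho c hcK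
  obtain ⟨r, hr, hr1, hball⟩ : ∃ r > 0, r ≤ 1 ∧ closedBall c r ⊆ K :=
    ⟨min (r₀ / 2) 1, by positivity, min_le_right _ _, (closedBall_subset_ball
      ((min_le_left _ _).trans_lt (by linarith))).trans hball₀⟩
  let s : ℕ → ℝ := fun n => 1 / ((n : ℝ) + 1 + 1)
  have hs : Tendsto s atTop (𝓝 0) := by
    have := (tendsto_add_atTop_iff_nat 1).2 (tendsto_one_div_add_atTop_nhds_zero_nat (𝕜 := ℝ))
    simpa [s] using this
  have hs0 : ∀ n, 0 < s n := fun n => by positivity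
  have hs2 : ∀ n, s n ≤ 1 / 2 := fun n => by
    apply one_div_le_one_div_of_le (by norm_num)
    linarith [(n.cast_nonneg : (0 : ℝ) ≤ n)]
  let t : ℕ → ℝ := fun n => 1 - s n
  have ht : Tendsto t atTop (𝓝 1) := by simpa using hs.const_sub 1
  have ht2 : ∀ n, 1 / 2 ≤ t n := fun n => by simp only [t]; linarith [hs2 n]
  have ht1 : ∀ n, t n ≤ 1 := fun n => by simp only [t]; linarith [hs0 n]
  -- The kernel radius `s n * r` matches the shrinking: with `t n = 1 - s n`, convexity puts the
  -- ball of this radius around `dilate c (t n) x` inside `K` for each `x ∈ K`.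
  let φ : ℕ → ContDiffBump (0 : Space d) := fun n =>
    ⟨s n * r / 2, s n * r, by have := hs0 n; positivity, by have := hs0 n; nlinarith⟩
  have hφ : Tendsto (fun n => (φ n).rOut) atTop (𝓝 0) := by simpa using hs.mul_const r
  have hφ1 : ∀ n, (φ n).rOut ≤ 1 := fun n => by
    show s n * r ≤ 1
    nlinarith [hs0 n, hs2 n]
  have hmem : ∀ {h : Space d → ℝ}, MemLp h 2 (volume.restrict K) → MemLp (K.indicator h) 2 volume :=
    fun hh => (memLp_indicator_iff_restrict ho.measurableSet).2 hh
  have hfl : LocallyIntegrable (K.indicator f) := (hmem hf.1).locallyIntegrable (by norm_num)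
  have hsm : ∀ n, ContDiff ℝ ∞ (mollify (φ n) (K.indicator f)) := fun n => contDiff_mollify _ hfl
  have hdil : ∀ n, ContDiff ℝ ∞ (dilate c (t n)) := fun n => by unfold dilate; fun_prop
  have hconv : ∀ {h : Space d → ℝ}, MemLp h 2 (volume.restrict K) →
      Tendsto (fun n => eLpNorm (fun x => mollify (φ n) (K.indicator h) (dilate c (t n) x) - h x) 2
        (volume.restrict K)) atTop (𝓝 0) := by
    intro h hh
    refine tendsto_of_tendsto_of_tendsto_of_le_of_le tendsto_const_nhds
      (tendsto_mollify_dilate (hmem hh) c hφ hφ1 ht ht2) (fun n => zero_le) fun n => ?_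
    refine le_trans (le_of_eq ?_) (eLpNorm_restrict_le _ 2 volume K)
    refine eLpNorm_congr_ae ?_
    filter_upwards [ae_restrict_mem ho.measurableSet] with x hx
    rw [Set.indicator_of_mem hx]
  refine ⟨fun n => mollify (φ n) (K.indicator f) ∘ dilate c (t n), fun n => (hsm n).comp (hdil n),
    hconv hf.1, fun j => ?_⟩
  obtain ⟨hg2, hgw⟩ := hf.weakPartial_spec j
  set g := weakPartial K f j with hg
  have hder : ∀ n, ∀ x ∈ K, fderiv ℝ (mollify (φ n) (K.indicator f) ∘ dilate c (t n)) x
      (EuclideanSpace.single j 1) = t n * mollify (φ n) (K.indicator g) (dilate c (t n) x) := by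
    intro n x hx
    have h1 : HasFDerivAt (dilate c (t n)) (t n • ContinuousLinearMap.id ℝ (Space d)) x :=
      (((hasFDerivAt_id x).sub_const c).const_smul (t n)).const_add c
    have h2 := ((hsm n).differentiable (by simp) (dilate c (t n) x)).hasFDerivAt.comp x h1
    rw [h2.fderiv]
    simp only [coe_comp, Function.comp_apply, _root_.smul_apply, id_apply, map_smul,
      smul_eq_mul]
    congr 1
    refine hgw.fderiv_mollify ho.measurableSet hfl (φ n) fun y hy => ?_
    have hsn := hs0 n
    -- This point `y'` of the ball of radius `r` at `c` is chosen so that `y = t n • x + s n • y'`.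
    have hy' : c + (s n)⁻¹ • (y - dilate c (t n) x) ∈ K := by
      refine hball ?_
      rw [mem_closedBall, dist_eq_norm] at hy ⊢
      rw [add_sub_cancel_left, norm_smul, norm_inv, Real.norm_of_nonneg hsn.le,
        inv_mul_le_iff₀ hsn]
      exact hy
    have := hc hx hy' (show 0 ≤ t n by linarith [ht2 n]) hsn.le (by simp only [t]; ring)
    convert this using 1
    rw [smul_add, smul_smul, mul_inv_cancel₀ hsn.ne', one_smul]
    simp only [dilate, t]
    module
  have hA := hconv hg2
  have hmeas : ∀ n, AEStronglyMeasurable (fun x => mollify (φ n) (K.indicator g) (dilate c (t n) x))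
      (volume.restrict K) := fun n =>
    ((contDiff_mollify (φ n) ((hmem hg2).locallyIntegrable (by norm_num))).continuous.comp
      (continuous_dilate c _)).aestronglyMeasurable
  -- The chain rule contributes a factor `t n`; as `t n = 1 - s n`, the error is `t n` times the
  -- mollification error minus `s n • g`.
  have hbound : ∀ n, eLpNorm (fun x => fderiv ℝ (mollify (φ n) (K.indicator f) ∘ dilate c (t n)) x
      (EuclideanSpace.single j 1) - g x) 2 (volume.restrict K) ≤
      eLpNorm (fun x => mollify (φ n) (K.indicator g) (dilate c (t n) x) - g x) 2
        (volume.restrict K) + ‖s n‖ₑ * eLpNorm g 2 (volume.restrict K) := by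
    intro n
    have e : (fun x => fderiv ℝ (mollify (φ n) (K.indicator f) ∘ dilate c (t n)) x
        (EuclideanSpace.single j 1) - g x) =ᵐ[volume.restrict K]
        (t n • (fun x => mollify (φ n) (K.indicator g) (dilate c (t n) x) - g x)) - s n • g := by
      filter_upwards [ae_restrict_mem ho.measurableSet] with x hx
      rw [hder n x hx]
      simp only [Pi.sub_apply, Pi.smul_apply, smul_eq_mul, t]
      ring
    rw [eLpNorm_congr_ae e]
    refine (eLpNorm_sub_le (((hmeas n).sub hg2.1).const_smul _) (hg2.1.const_smul _)
      (by norm_num)).trans ?_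
    rw [eLpNorm_const_smul, eLpNorm_const_smul]
    gcongr
    refine mul_le_of_le_one_left (zero_le) ?_
    rw [Real.enorm_eq_ofReal (by linarith [ht2 n]), ENNReal.ofReal_le_one]
    exact ht1 n
  refine tendsto_of_tendsto_of_tendsto_of_le_of_le tendsto_const_nhds ?_ (fun n => zero_le) hbound
  have h3 : Tendsto (fun n => ‖s n‖ₑ * eLpNorm g 2 (volume.restrict K)) atTop (𝓝 0) := by
    have := ENNReal.Tendsto.mul_const (b := eLpNorm g 2 (volume.restrict K)) hs.enorm
      (Or.inr hg2.2.ne)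
    simpa using this
  simpa using hA.add h3

end BrokenSobolev
end

noncomputable section

namespace BrokenSobolev

variable {d : ℕ}

open Metric Set
open scoped RealInnerProductSpace

/-! ### Cones over flat bases and the divergence theorem -/

/-- The cone with apex `p` over `A`. -/
def cone (p : Space d) (A : Set (Space d)) : Set (Space d) := convexJoin ℝ {p} A

lemma mem_cone_iff {p : Space d} {A : Set (Space d)} {x : Space d} :
    x ∈ cone p A ↔ ∃ y ∈ A, ∃ s ∈ Icc (0 : ℝ) 1, dilate p s y = x := by
  simp only [cone, convexJoin_singleton_left, mem_iUnion, segment_eq_image', exists_prop, dilate,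
    mem_image]

lemma IsCompact.cone {p : Space d} {A : Set (Space d)} (hA : IsCompact A) :
    IsCompact (cone p A) := by
  have : BrokenSobolev.cone p A = (fun q : ℝ × Space d => dilate p q.1 q.2) '' (Icc (0 : ℝ) 1 ×ˢ A) := by
    ext x
    rw [mem_cone_iff]
    simp only [mem_image, mem_prod, Prod.exists]
    constructor
    · rintro ⟨y, hy, s, hs, h⟩
      exact ⟨s, y, ⟨hs, hy⟩, h⟩
    · rintro ⟨s, y, ⟨hs, hy⟩, h⟩
      exact ⟨y, hy, s, hs, h⟩
  rw [this]
  refine (isCompact_Icc.prod hA).image ?_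
  unfold dilate
  fun_prop

lemma dilate_eq_homothety (p : Space d) (s : ℝ) : dilate p s = AffineMap.homothety p s := by
  funext x
  simp [dilate, AffineMap.homothety_apply, add_comm]

/-- Decomposition of the volume of a cone over a flat base along its cross-sections. -/
lemma volume_inter_cone {p v : Space d} (hv : v ≠ 0) {A : Set (Space d)} (hA : IsCompact A)
    (hAv : ∀ y ∈ A, ⟪v, y - p⟫ = ‖v‖ ^ 2) {t : Set (Space d)} (ht : MeasurableSet t) :
    volume (t ∩ cone p A) = ‖v‖ₑ * ∫⁻ s in Ioc (0 : ℝ) 1, ENNReal.ofReal (s ^ (d - 1)) *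
      Measure.euclideanHausdorffMeasure (d - 1) (dilate p s ⁻¹' t ∩ A) := by
  have h := EuclideanGeometry.euclideanHausdorffMeasure_eq_lintegral p hv
    (ht.inter (IsCompact.cone (p := p) hA).measurableSet)
  rw [finrank_euclideanSpace_fin, EuclideanSpace.euclideanHausdorffMeasure_eq_volume] at h
  rw [h, ← lintegral_indicator measurableSet_Ioc]
  congr 1
  have hv2 : ‖v‖ ^ 2 ≠ 0 := pow_ne_zero 2 (norm_ne_zero_iff.2 hv)
  have hmem : ∀ (s : ℝ) (x : Space d),
      x ∈ AffineSubspace.mk' (s • v +ᵥ p) (Submodule.span ℝ {v})ᗮ ↔ ⟪v, x - p⟫ = s * ‖v‖ ^ 2 := by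
    intro s x
    rw [AffineSubspace.mem_mk', Submodule.mem_orthogonal_singleton_iff_inner_right, vsub_eq_sub,
      vadd_eq_add, show x - (s • v + p) = (x - p) - s • v by abel, inner_sub_right, inner_smul_right,
      real_inner_self_eq_norm_sq, sub_eq_zero]
  have hcone : ∀ (s r : ℝ), ∀ y ∈ A, dilate p r y ∈
      AffineSubspace.mk' (s • v +ᵥ p) (Submodule.span ℝ {v})ᗮ ↔ r = s := by
    intro s r y hy
    rw [hmem, dilate, add_sub_cancel_left, inner_smul_right, hAv y hy]
    exact mul_left_inj' hv2
  refine lintegral_congr_ae ?_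
  -- The slice through the apex is discarded, because the scaling of the Hausdorff measure needs a
  -- nonzero ratio.
  have h0 : ∀ᵐ s : ℝ, s ≠ 0 := by simp [ae_iff]
  filter_upwards [h0] with s hs0
  by_cases hs : s ∈ Ioc (0 : ℝ) 1
  · rw [indicator_of_mem hs]
    have himg : t ∩ cone p A ∩ (AffineSubspace.mk' (s • v +ᵥ p) (Submodule.span ℝ {v})ᗮ : Set _) =
        AffineMap.homothety p s '' (dilate p s ⁻¹' t ∩ A) := by
      rw [← dilate_eq_homothety]
      ext x
      constructor
      · rintro ⟨⟨hxt, hxc⟩, hxs⟩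
        obtain ⟨y, hy, r, -, rfl⟩ := mem_cone_iff.1 hxc
        obtain rfl := (hcone s r y hy).1 hxs
        exact ⟨y, ⟨hxt, hy⟩, rfl⟩
      · rintro ⟨y, ⟨hyt, hy⟩, rfl⟩
        exact ⟨⟨hyt, mem_cone_iff.2 ⟨y, hy, s, ⟨hs.1.le, hs.2⟩, rfl⟩⟩, (hcone s s y hy).2 rfl⟩
    rw [himg, euclideanHausdorffMeasure_homothety_image _ _ hs.1.ne', ENNReal.smul_def, smul_eq_mul]
    congr 1
    rw [ENNReal.coe_pow, ENNReal.ofReal_pow hs.1.le, ← Real.enorm_eq_ofReal hs.1.le]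
    rfl
  · rw [indicator_of_notMem hs]
    refine (congrArg _ (eq_empty_iff_forall_notMem.2 ?_)).trans measure_empty
    rintro x ⟨⟨-, hxc⟩, hxs⟩
    obtain ⟨y, hy, r, hr, rfl⟩ := mem_cone_iff.1 hxc
    obtain rfl := (hcone s r y hy).1 hxs
    exact hs ⟨lt_of_le_of_ne hr.1 (Ne.symm hs0), hr.2⟩

/-- A compact subset of a hyperplane has finite surface measure. -/
lemma hausdorffMeasure_lt_top_of_inner_eq {p v : Space d} (hv : v ≠ 0) {A : Set (Space d)}
    (hA : IsCompact A) (hAv : ∀ y ∈ A, ⟪v, y - p⟫ = ‖v‖ ^ 2) :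
    Measure.euclideanHausdorffMeasure (d - 1) A < ⊤ := by
  have h := volume_inter_cone hv hA hAv MeasurableSet.univ
  simp only [univ_inter, preimage_univ] at h
  have hlt : volume (cone p A) < ⊤ := (IsCompact.cone hA).measure_lt_top
  rw [lintegral_mul_const _ (by fun_prop)] at h
  -- The cone is compact, so its volume is finite, whereas a base of infinite measure would make the
  -- product in `h` infinite.
  by_contra htop
  rw [not_lt, top_le_iff] at htop
  have hne : ∫⁻ s in Ioc (0 : ℝ) 1, ENNReal.ofReal (s ^ (d - 1)) ≠ 0 := by
    rw [← setLIntegral_congr Ioo_ae_eq_Ioc]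
    refine (setLIntegral_pos_iff (by fun_prop)).2 ?_ |>.ne'
    have : Function.support (fun s : ℝ => ENNReal.ofReal (s ^ (d - 1))) ∩ Ioo 0 1 = Ioo 0 1 := by
      refine inter_eq_right.2 fun s hs => ?_
      simp only [Function.mem_support, ne_eq, ENNReal.ofReal_eq_zero, not_le]
      exact pow_pos hs.1 _
    rw [this]
    simp
  rw [htop, ENNReal.mul_top hne, ENNReal.mul_top (by simpa using hv)] at h
  exact hlt.ne h

/-- The volume measure of a cone in polar coordinates around its apex. -/
lemma volume_restrict_cone {p v : Space d} (hv : v ≠ 0) {A : Set (Space d)} (hA : IsCompact A)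
    (hAv : ∀ y ∈ A, ⟪v, y - p⟫ = ‖v‖ ^ 2) :
    volume.restrict (cone p A) = ‖v‖ₑ • (((volume.restrict (Ioc (0 : ℝ) 1)).withDensity
      fun s => ENNReal.ofReal (s ^ (d - 1))).prod
        ((Measure.euclideanHausdorffMeasure (d - 1)).restrict A)).map
          fun q : ℝ × Space d => dilate p q.1 q.2 := by
  have hfin : IsFiniteMeasure ((Measure.euclideanHausdorffMeasure (d - 1)).restrict A) :=
    ⟨by simpa using hausdorffMeasure_lt_top_of_inner_eq hv hA hAv⟩
  have hm : Measurable fun q : ℝ × Space d => dilate p q.1 q.2 := by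
    unfold dilate
    fun_prop
  ext t ht
  rw [Measure.restrict_apply ht, volume_inter_cone hv hA hAv ht, Measure.smul_apply, smul_eq_mul,
    Measure.map_apply hm ht, Measure.prod_apply (hm ht),
    lintegral_withDensity_eq_lintegral_mul _ (by fun_prop) (measurable_measure_prodMk_left (hm ht))]
  congr 1
  refine lintegral_congr fun s => ?_
  rw [Pi.mul_apply, Measure.restrict_apply (measurable_prodMk_left (hm ht))]
  rfl

/-- The divergence theorem on a cone for the field `g(x) (x - p)`, which is tangential to the
lateral boundary. -/
lemma integral_cone (hd : 0 < d) {p v : Space d} (hv : v ≠ 0) {A : Set (Space d)}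
    (hA : IsCompact A) (hAv : ∀ y ∈ A, ⟪v, y - p⟫ = ‖v‖ ^ 2) {g : Space d → ℝ}
    (hg : ContDiff ℝ 1 g) :
    ∫ x in cone p A, ((d : ℝ) * g x + fderiv ℝ g x (x - p)) =
      ‖v‖ * ∫ y in A, g y ∂(Measure.euclideanHausdorffMeasure (d - 1)) := by
  have hfin : IsFiniteMeasure ((Measure.euclideanHausdorffMeasure (d - 1)).restrict A) :=
    ⟨by simpa using hausdorffMeasure_lt_top_of_inner_eq hv hA hAv⟩
  set G : Space d → ℝ := fun x => (d : ℝ) * g x + fderiv ℝ g x (x - p) with hG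
  have hGc : Continuous G := by
    have h1 := hg.continuous
    have h2 := hg.continuous_fderiv (by simp)
    fun_prop
  have hm : Measurable fun q : ℝ × Space d => dilate p q.1 q.2 := by
    unfold dilate
    fun_prop
  have hGi : Integrable G (volume.restrict (cone p A)) :=
    hGc.continuousOn.integrableOn_compact (IsCompact.cone hA)
  have hmeq := volume_restrict_cone hv hA hAv
  have hGi' := hGi
  rw [hmeq] at hGi'
  have hve : ‖v‖ₑ ≠ 0 := by simpa using hv
  rw [integrable_smul_measure hve (by simp), integrable_map_measure
    hGc.aestronglyMeasurable hm.aemeasurable] at hGi'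
  rw [hmeq, integral_smul_measure, integral_map hm.aemeasurable hGc.aestronglyMeasurable,
    integral_prod_symm (fun q : ℝ × Space d => G (dilate p q.1 q.2)) hGi', toReal_enorm, smul_eq_mul]
  congr 1
  refine integral_congr_ae (ae_of_all _ fun y => ?_)
  have e : ∫ s, G (dilate p s y) ∂((volume.restrict (Ioc (0 : ℝ) 1)).withDensity
      fun s => ENNReal.ofReal (s ^ (d - 1))) =
      ∫ s in Ioc (0 : ℝ) 1, s ^ (d - 1) * G (dilate p s y) := by
    rw [integral_withDensity_eq_integral_toReal_smul (by fun_prop) (ae_of_all _ fun s =>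
      ENNReal.ofReal_lt_top)]
    refine setIntegral_congr_fun measurableSet_Ioc fun s hs => ?_
    simp only [smul_eq_mul]
    rw [ENNReal.toReal_ofReal (pow_nonneg hs.1.le _)]
  show ∫ s, G (dilate p s y) ∂_ = g y
  rw [e, ← intervalIntegral.integral_of_le zero_le_one]
  have hdil : ∀ s, HasDerivAt (fun s => dilate p s y) (y - p) s := fun s => by
    have := ((hasDerivAt_id s).smul_const (y - p)).const_add p
    simpa [dilate] using this
  -- Along the ray through `y`, the integrand weighted by the Jacobian `s ^ (d - 1)` is an exact
  -- derivative. Only the endpoint `s = 1` contributes, since `s ^ d` vanishes at `0` for `d > 0`.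
  have hder : ∀ s, HasDerivAt (fun s => s ^ d * g (dilate p s y))
      (s ^ (d - 1) * G (dilate p s y)) s := by
    intro s
    have h1 := (hasDerivAt_pow d s).mul
      (((hg.differentiable (by simp) (dilate p s y)).hasFDerivAt).comp_hasDerivAt s (hdil s))
    refine h1.congr_deriv ?_
    have h2 : dilate p s y - p = s • (y - p) := by simp [dilate]
    have h3 : s ^ d = s ^ (d - 1) * s := by
      rw [← pow_succ, Nat.sub_add_cancel hd]
    simp only [hG, Function.comp]
    rw [h2, map_smul, smul_eq_mul, h3]
    ring
  have hcont : Continuous fun s => s ^ (d - 1) * G (dilate p s y) := by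
    have : Continuous fun s => dilate p s y := by unfold dilate; fun_prop
    fun_prop
  rw [intervalIntegral.integral_eq_sub_of_hasDerivAt (fun s _ => hder s)
    (hcont.intervalIntegrable _ _)]
  simp [dilate, hd.ne']

/-! ### Face normals and calculus on a simplex -/

lemma exists_unit_normal {F : Finset (Space d)} (hF : F.card ≤ d) (hF0 : F.Nonempty) :
    ∃ n : Space d, ∃ b : ℝ, ‖n‖ = 1 ∧ ∀ y ∈ F, ⟪n, y⟫ = b := by
  obtain ⟨y₀, hy₀⟩ := hF0
  -- At most `d` points span at most `d - 1` directions, which leaves a nonzero orthogonal vector.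
  have hlt : Module.finrank ℝ (vectorSpan ℝ (F : Set (Space d))) < d := by
    obtain ⟨m, hm⟩ := Nat.exists_eq_succ_of_ne_zero (Finset.card_ne_zero_of_mem hy₀)
    have h1 : Module.finrank ℝ (vectorSpan ℝ (F : Set (Space d))) ≤ m := by
      classical
      have := finrank_vectorSpan_image_finset_le ℝ (id : Space d → Space d) F hm
      rwa [Finset.image_id] at this
    omega
  have hne : (vectorSpan ℝ (F : Set (Space d)))ᗮ ≠ ⊥ := by
    intro h
    rw [Submodule.orthogonal_eq_bot_iff] at h
    rw [h, finrank_top, finrank_euclideanSpace_fin] at hlt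
    exact hlt.false
  obtain ⟨w, hw, hw0⟩ := Submodule.exists_mem_ne_zero_of_ne_bot hne
  refine ⟨‖w‖⁻¹ • w, ⟪‖w‖⁻¹ • w, y₀⟫, norm_smul_inv_norm hw0, fun y hy => ?_⟩
  rw [← sub_eq_zero, ← inner_sub_right, inner_smul_left]
  have : ⟪y - y₀, w⟫ = 0 := hw _ (vsub_mem_vectorSpan ℝ hy hy₀)
  rw [real_inner_comm, this, mul_zero]

open Classical in
/-- A unit normal to the face `F`. -/
def faceNormal (F : Finset (Space d)) : Space d :=
  if h : ∃ n : Space d, ∃ b : ℝ, ‖n‖ = 1 ∧ ∀ y ∈ F, ⟪n, y⟫ = b then h.choose else 0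

open Classical in
/-- The constant value of `⟪faceNormal F, ·⟫` on the face `F`. -/
def faceOffset (F : Finset (Space d)) : ℝ :=
  if h : ∃ n : Space d, ∃ b : ℝ, ‖n‖ = 1 ∧ ∀ y ∈ F, ⟪n, y⟫ = b then h.choose_spec.choose else 0

lemma norm_faceNormal {F : Finset (Space d)} (hF : F.card ≤ d) (hF0 : F.Nonempty) :
    ‖faceNormal F‖ = 1 := by
  have h := exists_unit_normal hF hF0
  rw [faceNormal, dif_pos h]
  exact h.choose_spec.choose_spec.1

lemma inner_faceNormal {F : Finset (Space d)} (hF : F.card ≤ d) {y : Space d} (hy : y ∈ F) :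
    ⟪faceNormal F, y⟫ = faceOffset F := by
  have h := exists_unit_normal hF ⟨y, hy⟩
  rw [faceNormal, faceOffset, dif_pos h, dif_pos h]
  exact h.choose_spec.choose_spec.2 y hy

lemma inner_faceNormal_of_mem_convexHull {F : Finset (Space d)} (hF : F.card ≤ d) {y : Space d}
    (hy : y ∈ convexHull ℝ (F : Set (Space d))) : ⟪faceNormal F, y⟫ = faceOffset F := by
  have hconv : Convex ℝ {y : Space d | ⟪faceNormal F, y⟫ = faceOffset F} :=
    convex_hyperplane (innerₛₗ ℝ (faceNormal F)).isLinear _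
  exact convexHull_min (fun y hy => inner_faceNormal hF hy) hconv hy

/-- The signed distance to the hyperplane of `F` of the vertex of `K` opposite to `F`. -/
def side (K F : Finset (Space d)) : ℝ := ∑ q ∈ K, (faceOffset F - ⟪faceNormal F, q⟫)

lemma restrict_openCell (K : Finset (Space d)) :
    (volume : Measure (Space d)).restrict (openCell K) =
      volume.restrict (convexHull ℝ (K : Set (Space d))) :=
  Measure.restrict_congr_set (interior_ae_eq_of_null_frontier
    ((convex_convexHull ℝ _).addHaar_frontier volume))

lemma integrable_openCell {G : Space d → ℝ} (hG : Continuous G) (K : Finset (Space d)) :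
    Integrable G (volume.restrict (openCell K)) := by
  rw [restrict_openCell]
  exact hG.continuousOn.integrableOn_compact (K.finite_toSet.isCompact_convexHull (𝕜 := ℝ))

lemma eLpNorm_two_sq_eq_integral {α : Type*} [MeasurableSpace α]
    {μ : Measure α} {f : α → ℝ} (hf : Integrable (fun x => f x ^ 2) μ) :
    eLpNorm f 2 μ ^ 2 = ENNReal.ofReal (∫ x, f x ^ 2 ∂μ) := by
  rw [eLpNorm_two_sq, ofReal_integral_eq_lintegral_ofReal hf (ae_of_all _ fun x => sq_nonneg _)]
  refine lintegral_congr fun x => ?_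
  rw [← sq_abs, ENNReal.ofReal_pow (abs_nonneg _), ← Real.norm_eq_abs, ofReal_norm]

lemma memLp_surfaceMeasure {E : Type*} [NormedAddCommGroup E]
    [SecondCountableTopologyEither (Space d) E] {F : Finset (Space d)}
    [IsFiniteMeasure (surfaceMeasure F)] {f : Space d → E} (hf : Continuous f) (q : ℝ≥0∞) :
    MemLp f q (surfaceMeasure F) := by
  have hc : IsCompact (convexHull ℝ (F : Set (Space d))) :=
    F.finite_toSet.isCompact_convexHull (𝕜 := ℝ)
  obtain ⟨C, hC⟩ := hc.exists_bound_of_continuousOn hf.continuousOn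
  exact MemLp.of_bound hf.aestronglyMeasurable C
    (by filter_upwards [ae_restrict_mem hc.measurableSet] with x hx using hC x hx)

/-- `K` is the vertex set of a nondegenerate `d`-dimensional simplex. -/
structure IsCell (K : Finset (Space d)) : Prop where
  card : K.card = d + 1
  indep : AffineIndependent ℝ ((↑) : K → Space d)

namespace IsCell

variable {K : Finset (Space d)}

lemma vectorSpan_eq_top (hK : IsCell K) : vectorSpan ℝ (K : Set (Space d)) = ⊤ := by
  have h := hK.indep.vectorSpan_eq_top_of_card_eq_finrank_add_one
    (by simp [hK.card])
  simpa using h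

/-- Such weights give `∑ α q • (x - q) = -a` for every `x`. Thus the radial fields `x - q`, for
which the divergence theorem is available, generate the constant fields. -/
lemma exists_weights (hK : IsCell K) (a : Space d) :
    ∃ α : Space d → ℝ, ∑ q ∈ K, α q = 0 ∧ ∑ q ∈ K, α q • q = a := by
  classical
  have ha : a ∈ vectorSpan ℝ (K : Set (Space d)) := by rw [hK.vectorSpan_eq_top]; trivial
  rw [vectorSpan_def] at ha
  induction ha using Submodule.span_induction with
  | mem x hx =>
    obtain ⟨q, hq, r, hr, rfl⟩ := Set.mem_vsub.1 hx
    have hq' : q ∈ K := hq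
    have hr' : r ∈ K := hr
    refine ⟨fun z => (if z = q then 1 else 0) - (if z = r then 1 else 0), ?_, ?_⟩
    · simp [Finset.sum_sub_distrib, hq', hr']
    · simp [sub_smul, Finset.sum_sub_distrib, ite_smul, hq', hr']
  | zero => exact ⟨0, by simp, by simp⟩
  | add x y _ _ hx hy =>
    obtain ⟨α, h1, h2⟩ := hx
    obtain ⟨β, h3, h4⟩ := hy
    refine ⟨α + β, ?_, ?_⟩
    · simp [Finset.sum_add_distrib, h1, h3]
    · simp [add_smul, Finset.sum_add_distrib, h2, h4]
  | smul c x _ hx =>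
    obtain ⟨α, h1, h2⟩ := hx
    refine ⟨c • α, ?_, ?_⟩
    · simp [← Finset.mul_sum, h1]
    · simp [mul_smul, ← Finset.smul_sum, h2]

variable [DecidableEq (Space d)]

lemma card_erase (hK : IsCell K) {p : Space d} (hp : p ∈ K) : (K.erase p).card = d := by
  rw [Finset.card_erase_of_mem hp, hK.card]; rfl

lemma side_erase (hK : IsCell K) {p : Space d} (hp : p ∈ K) :
    side K (K.erase p) = faceOffset (K.erase p) - ⟪faceNormal (K.erase p), p⟫ := by
  rw [side, ← Finset.add_sum_erase K _ hp, Finset.sum_eq_zero, add_zero]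
  intro q hq
  rw [inner_faceNormal (hK.card_erase hp).le hq, sub_self]

/-- Otherwise the unit normal would pair equally with all vertices of `K`. Written as a combination
of the vertices with zero total weight, it would then be orthogonal to itself. -/
lemma side_erase_ne_zero (hd : 0 < d) (hK : IsCell K) {p : Space d} (hp : p ∈ K) :
    side K (K.erase p) ≠ 0 := by
  intro h
  rw [hK.side_erase hp, sub_eq_zero] at h
  have hcard := hK.card_erase hp
  have hne : (K.erase p).Nonempty := Finset.card_pos.1 (by omega)
  have hall : ∀ q ∈ K, ⟪faceNormal (K.erase p), q⟫ = faceOffset (K.erase p) := by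
    intro q hq
    by_cases hqp : q = p
    · rw [hqp, h]
    · exact inner_faceNormal hcard.le (Finset.mem_erase.2 ⟨hqp, hq⟩)
  obtain ⟨α, h1, h2⟩ := hK.exists_weights (faceNormal (K.erase p))
  have h3 : ⟪faceNormal (K.erase p), faceNormal (K.erase p)⟫ = 0 := by
    conv_lhs => arg 3; rw [← h2]
    rw [inner_sum]
    simp only [inner_smul_right]
    rw [Finset.sum_congr rfl fun q hq => by rw [hall q hq], ← Finset.sum_mul, h1, zero_mul]
  rw [real_inner_self_eq_norm_sq, norm_faceNormal hcard.le hne] at h3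
  norm_num at h3

lemma convexHull_eq_cone (hd : 0 < d) (hK : IsCell K) {p : Space d} (hp : p ∈ K) :
    convexHull ℝ (K : Set (Space d)) = cone p (convexHull ℝ ((K.erase p : Finset (Space d)) : Set (Space d))) := by
  have hne : (K.erase p).Nonempty := Finset.card_pos.1 (by rw [hK.card_erase hp]; exact hd)
  conv_lhs => rw [← Finset.insert_erase hp]
  rw [Finset.coe_insert, convexHull_insert (by exact_mod_cast hne), cone]

/-- The vector from the vertex `p` of `K` to the opposite face, orthogonal to that face. -/
lemma altitude (hd : 0 < d) (hK : IsCell K) {p : Space d} (hp : p ∈ K) :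
    ∃ v : Space d, v ≠ 0 ∧ ‖v‖ = |side K (K.erase p)| ∧
      ∀ y ∈ convexHull ℝ ((K.erase p : Finset (Space d)) : Set (Space d)), ⟪v, y - p⟫ = ‖v‖ ^ 2 := by
  have hcard := hK.card_erase hp
  have hne : (K.erase p).Nonempty := Finset.card_pos.1 (by omega)
  have hn := norm_faceNormal hcard.le hne
  have hs := hK.side_erase_ne_zero hd hp
  have hnorm : ‖side K (K.erase p) • faceNormal (K.erase p)‖ = |side K (K.erase p)| := by
    rw [norm_smul, hn, mul_one, Real.norm_eq_abs]
  refine ⟨side K (K.erase p) • faceNormal (K.erase p), ?_, hnorm, fun y hy => ?_⟩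
  · rw [← norm_ne_zero_iff, hnorm]
    exact abs_ne_zero.2 hs
  · rw [hnorm, sq_abs, real_inner_smul_left, inner_sub_right,
      inner_faceNormal_of_mem_convexHull hcard.le (by exact_mod_cast hy), ← hK.side_erase hp, sq]

lemma isFiniteMeasure_surfaceMeasure (hd : 0 < d) (hK : IsCell K) {p : Space d} (hp : p ∈ K) :
    IsFiniteMeasure (surfaceMeasure (K.erase p)) := by
  obtain ⟨v, hv, -, hA⟩ := hK.altitude hd hp
  refine ⟨?_⟩
  rw [surfaceMeasure, Measure.restrict_apply_univ]
  exact hausdorffMeasure_lt_top_of_inner_eq hv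
    ((K.erase p).finite_toSet.isCompact_convexHull (𝕜 := ℝ)) hA

/-- The divergence theorem for `g(x) (x - p)` on the simplex `K`, where `p` is a vertex of `K`. -/
lemma integral_openCell (hd : 0 < d) (hK : IsCell K) {p : Space d} (hp : p ∈ K)
    {g : Space d → ℝ} (hg : ContDiff ℝ 1 g) :
    ∫ x in openCell K, ((d : ℝ) * g x + fderiv ℝ g x (x - p)) =
      |side K (K.erase p)| * ∫ y, g y ∂(surfaceMeasure (K.erase p)) := by
  obtain ⟨v, hv, hvn, hA⟩ := hK.altitude hd hp
  rw [restrict_openCell, hK.convexHull_eq_cone hd hp, ← hvn, surfaceMeasure]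
  exact integral_cone hd hv ((K.erase p).finite_toSet.isCompact_convexHull (𝕜 := ℝ)) hA hg

/-- Integration of a directional derivative over a simplex. -/
lemma integral_fderiv (hd : 0 < d) (hK : IsCell K) {g : Space d → ℝ} (hg : ContDiff ℝ 1 g)
    (a : Space d) :
    ∫ x in openCell K, fderiv ℝ g x a = ∑ p ∈ K, (SignType.sign (side K (K.erase p)) : ℝ) *
      ⟪faceNormal (K.erase p), a⟫ * ∫ y, g y ∂(surfaceMeasure (K.erase p)) := by
  obtain ⟨α, h1, h2⟩ := hK.exists_weights a
  have hgc := hg.continuous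
  have hgc' := hg.continuous_fderiv (by simp)
  -- The terms `d * g x` and `fderiv ℝ g x x` drop out because the weights sum to zero.
  have hpt : ∀ x, ∑ p ∈ K, α p * ((d : ℝ) * g x + fderiv ℝ g x (x - p)) = - fderiv ℝ g x a := by
    intro x
    have e : ∀ p, α p * ((d : ℝ) * g x + fderiv ℝ g x (x - p)) =
        α p * ((d : ℝ) * g x + fderiv ℝ g x x) - fderiv ℝ g x (α p • p) := by
      intro p
      rw [map_sub, map_smul, smul_eq_mul]
      ring
    simp only [e]
    rw [Finset.sum_sub_distrib, ← Finset.sum_mul, h1, ← map_sum, h2]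
    ring
  have hInt : ∫ x in openCell K, fderiv ℝ g x a =
      - ∑ p ∈ K, α p * ∫ x in openCell K, ((d : ℝ) * g x + fderiv ℝ g x (x - p)) := by
    simp only [← integral_const_mul]
    rw [← integral_finsetSum _ fun p _ => integrable_openCell (by fun_prop) K]
    simp only [hpt, integral_neg, neg_neg]
  rw [hInt, ← Finset.sum_neg_distrib]
  refine Finset.sum_congr rfl fun p hp => ?_
  -- All vertices except `p` have the same normal component, so only the height of `p` over the face
  -- remains.
  have hα : ⟪faceNormal (K.erase p), a⟫ = - (α p * side K (K.erase p)) := by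
    rw [← h2, inner_sum, hK.side_erase hp]
    simp only [inner_smul_right]
    have h3 := h1
    rw [← Finset.add_sum_erase K _ hp] at h3 ⊢
    rw [Finset.sum_congr rfl fun q hq => by
      rw [inner_faceNormal (hK.card_erase hp).le hq], ← Finset.sum_mul,
      show ∑ q ∈ K.erase p, α q = - α p by linarith]
    ring
  rw [hK.integral_openCell hd hp hg, hα, ← self_mul_sign (side K (K.erase p))]
  ring

/-- The trace inequality for smooth functions on a simplex. -/
lemma exists_trace_bound (hd : 0 < d) (hK : IsCell K) {p : Space d} (hp : p ∈ K) :
    ∃ C : ℝ, ∀ g : Space d → ℝ, ContDiff ℝ 1 g →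
      eLpNorm g 2 (surfaceMeasure (K.erase p)) ^ 2 ≤ ENNReal.ofReal C *
        (eLpNorm g 2 (volume.restrict (openCell K)) ^ 2 +
          ∑ j, eLpNorm (fun x => fderiv ℝ g x (EuclideanSpace.single j 1)) 2
            (volume.restrict (openCell K)) ^ 2) := by
  have hfin := hK.isFiniteMeasure_surfaceMeasure hd hp
  obtain ⟨D, hD⟩ : ∃ D, ∀ x ∈ openCell K, ‖x - p‖ ≤ D := by
    have hb : Bornology.IsBounded (openCell K) :=
      (K.finite_toSet.isCompact_convexHull (𝕜 := ℝ)).isBounded.subset interior_subset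
    obtain ⟨D, hD⟩ := hb.subset_closedBall p
    exact ⟨D, fun x hx => by simpa [dist_eq_norm] using hD hx⟩
  set s := |side K (K.erase p)| with hs
  have hs0 : 0 < s := abs_pos.2 (hK.side_erase_ne_zero hd hp)
  -- With `X` the derivative of `g` along `x - p`, one has `2 g X ≤ g² + X²`, and Cauchy–Schwarz
  -- bounds `X²` by `D²` times the squared gradient. `M` dominates both resulting coefficients, `d +
  -- 1` and `D²`.
  set M : ℝ := (d : ℝ) + 1 + d * D ^ 2 with hM
  have hM0 : 0 ≤ M := by positivity
  refine ⟨s⁻¹ * M, fun g hg => ?_⟩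
  have hgc := hg.continuous
  have hgc' := hg.continuous_fderiv (by simp)
  have hdc : ∀ j : Fin d, Continuous fun x => fderiv ℝ g x (EuclideanSpace.single j 1) := fun j =>
    hgc'.clm_apply continuous_const
  have hF : Integrable (fun x => g x ^ 2) (surfaceMeasure (K.erase p)) :=
    memLp_one_iff_integrable.1 (memLp_surfaceMeasure (hgc.pow 2) 1)
  rw [eLpNorm_two_sq_eq_integral hF, eLpNorm_two_sq_eq_integral (integrable_openCell (hgc.pow 2) K),
    Finset.sum_congr rfl fun j _ =>
      eLpNorm_two_sq_eq_integral (integrable_openCell ((hdc j).pow 2) K),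
    ← ENNReal.ofReal_sum_of_nonneg fun j _ => integral_nonneg fun x => sq_nonneg _,
    ← ENNReal.ofReal_add (integral_nonneg fun x => sq_nonneg _)
      (Finset.sum_nonneg fun j _ => integral_nonneg fun x => sq_nonneg _),
    ← ENNReal.ofReal_mul (by positivity)]
  refine ENNReal.ofReal_le_ofReal ?_
  have key := hK.integral_openCell hd hp (hg.pow 2)
  have hle : ∫ x in openCell K, ((d : ℝ) * g x ^ 2 + fderiv ℝ (fun y => g y ^ 2) x (x - p)) ≤
      ∫ x in openCell K, M * (g x ^ 2 + ∑ j, fderiv ℝ g x (EuclideanSpace.single j 1) ^ 2) := by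
    refine setIntegral_mono_on (integrable_openCell ?_ K) (integrable_openCell ?_ K)
      isOpen_interior.measurableSet fun x hx => ?_
    · have h1 := (hg.pow 2).continuous_fderiv (by simp)
      fun_prop
    · fun_prop
    have hder : fderiv ℝ (fun y => g y ^ 2) x (x - p) = 2 * g x * fderiv ℝ g x (x - p) := by
      rw [((hg.differentiable (by simp) x).hasFDerivAt.pow 2).fderiv]
      simp
    have hexp : fderiv ℝ g x (x - p) =
        ∑ j, (x - p) j * fderiv ℝ g x (EuclideanSpace.single j 1) := by
      conv_lhs => rw [← (EuclideanSpace.basisFun (Fin d) ℝ).sum_repr (x - p)]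
      simp
    have hcs : fderiv ℝ g x (x - p) ^ 2 ≤
        D ^ 2 * ∑ j, fderiv ℝ g x (EuclideanSpace.single j 1) ^ 2 := by
      rw [hexp]
      refine (Finset.sum_mul_sq_le_sq_mul_sq _ _ _).trans ?_
      refine mul_le_mul_of_nonneg_right ?_ (Finset.sum_nonneg fun j _ => sq_nonneg _)
      have h1 : ∑ j, (x - p) j ^ 2 = ‖x - p‖ ^ 2 := by
        rw [EuclideanSpace.norm_sq_eq]
        simp
      rw [h1]
      exact pow_le_pow_left₀ (norm_nonneg _) (hD x hx) 2
    set S := ∑ j, fderiv ℝ g x (EuclideanSpace.single j 1) ^ 2 with hS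
    have hS0 : 0 ≤ S := Finset.sum_nonneg fun j _ => sq_nonneg _
    have hd1 : (1 : ℝ) ≤ d := by exact_mod_cast hd
    have h4 : D ^ 2 * S ≤ d * D ^ 2 * S := by
      have : 0 ≤ D ^ 2 * S := by positivity
      nlinarith
    have h5 : 0 ≤ d * D ^ 2 * g x ^ 2 := by positivity
    have h6 : 0 ≤ ((d : ℝ) + 1) * S := by positivity
    rw [hder, hM]
    nlinarith [sq_nonneg (g x - fderiv ℝ g x (x - p))]
  rw [key, integral_const_mul, integral_add (f := fun x => g x ^ 2) (integrable_openCell (hgc.pow 2) K)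
    (integrable_openCell (by fun_prop) K),
    integral_finsetSum (f := fun j x => fderiv ℝ g x (EuclideanSpace.single j 1) ^ 2) _
      fun j _ => integrable_openCell ((hdc j).pow 2) K] at hle
  rw [mul_assoc, le_inv_mul_iff₀ hs0]
  exact hle

end IsCell

end BrokenSobolev
end

noncomputable section

namespace BrokenSobolev

variable {d : ℕ}

open Metric Set
open scoped RealInnerProductSpace

/-! ### Existence and uniqueness of traces -/

lemma eLpNorm_two_sq_eq_sum {α : Type*} [MeasurableSpace α] {μ : Measure α} {f : α → Space d}
    (hf : AEStronglyMeasurable f μ) :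
    eLpNorm f 2 μ ^ 2 = ∑ i, eLpNorm (fun x => f x i) 2 μ ^ 2 := by
  have hfi : ∀ i, AEStronglyMeasurable (fun x => f x i) μ := fun i =>
    (EuclideanSpace.proj (𝕜 := ℝ) i).continuous.comp_aestronglyMeasurable hf
  simp only [eLpNorm_two_sq]
  rw [← lintegral_finsetSum' _ fun i _ => (hfi i).enorm.pow_const 2]
  refine lintegral_congr fun x => ?_
  rw [← ofReal_norm, ← ENNReal.ofReal_pow (norm_nonneg _), EuclideanSpace.norm_sq_eq,
    ENNReal.ofReal_sum_of_nonneg fun i _ => sq_nonneg _]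
  refine Finset.sum_congr rfl fun i _ => ?_
  rw [ENNReal.ofReal_pow (norm_nonneg _), ofReal_norm]

lemma fderiv_apply_coord {u : Space d → Space d} (hu : ContDiff ℝ ∞ u) (x v : Space d) (i : Fin d) :
    fderiv ℝ u x v i = fderiv ℝ (fun y => u y i) x v := by
  have h := (EuclideanSpace.proj i : Space d →L[ℝ] ℝ).hasFDerivAt.comp x
    (hu.differentiable (by simp) x).hasFDerivAt
  have h2 : (fun y => u y i) = (EuclideanSpace.proj i : Space d →L[ℝ] ℝ) ∘ u := rfl
  rw [h2, h.fderiv]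
  rfl

/-- The distance in `H¹(K)^d` of a smooth field `u` from `w`. -/
def h1Dist (K : Finset (Space d)) (u w : Space d → Space d) : ℝ≥0∞ :=
  eLpNorm (fun x => u x - w x) 2 (volume.restrict (openCell K)) +
    ∑ i, ∑ j, eLpNorm (fun x => fderiv ℝ u x (EuclideanSpace.single j 1) i -
      weakPartial (openCell K) (fun y => w y i) j x) 2 (volume.restrict (openCell K))

lemma tendsto_h1Dist_iff {K : Finset (Space d)} {u : ℕ → Space d → Space d}
    {w : Space d → Space d} : Tendsto (fun n => h1Dist K (u n) w) atTop (𝓝 0) ↔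
    Tendsto (fun n => eLpNorm (fun x => u n x - w x) 2 (volume.restrict (openCell K)))
      atTop (𝓝 0) ∧
    ∀ i j : Fin d, Tendsto (fun n => eLpNorm
        (fun x => fderiv ℝ (u n) x (EuclideanSpace.single j 1) i -
          weakPartial (openCell K) (fun y => w y i) j x) 2 (volume.restrict (openCell K)))
      atTop (𝓝 0) := by
  constructor
  · intro h
    refine ⟨tendsto_of_tendsto_of_tendsto_of_le_of_le tendsto_const_nhds h (fun _ => zero_le)
      fun n => le_self_add, fun i j => tendsto_of_tendsto_of_tendsto_of_le_of_le tendsto_const_nhds h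
      (fun _ => zero_le) fun n => ?_⟩
    have h1 := Finset.single_le_sum (f := fun j => eLpNorm
        (fun x => fderiv ℝ (u n) x (EuclideanSpace.single j 1) i -
          weakPartial (openCell K) (fun y => w y i) j x) 2 (volume.restrict (openCell K)))
      (fun _ _ => zero_le) (Finset.mem_univ j)
    have h2 := Finset.single_le_sum (f := fun i => ∑ j, eLpNorm
        (fun x => fderiv ℝ (u n) x (EuclideanSpace.single j 1) i -
          weakPartial (openCell K) (fun y => w y i) j x) 2 (volume.restrict (openCell K)))
      (fun _ _ => zero_le) (Finset.mem_univ i)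
    exact (h1.trans h2).trans le_add_self
  · rintro ⟨h1, h2⟩
    have := h1.add (tendsto_finsetSum Finset.univ fun i _ =>
      tendsto_finsetSum Finset.univ fun j _ => h2 i j)
    simpa [h1Dist] using this

lemma hasTrace_iff {K F : Finset (Space d)} {w : Space d → Space d}
    {g : Lp (Space d) 2 (surfaceMeasure F)} : HasTrace K F w g ↔
      ∃ u : ℕ → Space d → Space d, (∀ n, ContDiff ℝ ∞ (u n)) ∧
        Tendsto (fun n => h1Dist K (u n) w) atTop (𝓝 0) ∧
        Tendsto (fun n => eLpNorm (fun x => u n x - g x) 2 (surfaceMeasure F)) atTop (𝓝 0) := by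
  simp only [HasTrace, tendsto_h1Dist_iff, and_assoc]

/-- Smooth fields are dense in `H¹(K)^d`. -/
lemma exists_tendsto_h1Dist {K : Finset (Space d)} {w : Space d → Space d}
    (hw : ∀ i, MemH1 (openCell K) fun x => w x i) :
    ∃ u : ℕ → Space d → Space d, (∀ n, ContDiff ℝ ∞ (u n)) ∧
      Tendsto (fun n => h1Dist K (u n) w) atTop (𝓝 0) := by
  have hconv : Convex ℝ (openCell K) := (convex_convexHull ℝ _).interior
  have hb : Bornology.IsBounded (openCell K) :=
    (K.finite_toSet.isCompact_convexHull (𝕜 := ℝ)).isBounded.subset interior_subset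
  choose v hvs hv hvd using fun i => (hw i).exists_smooth_approx hconv isOpen_interior hb
  have hus : ∀ n, ContDiff ℝ ∞ fun x => (WithLp.toLp 2 fun i => v i n x : Space d) := fun n =>
    contDiff_euclidean.2 fun i => hvs i n
  refine ⟨fun n x => WithLp.toLp 2 fun i => v i n x, hus, ?_⟩
  rw [tendsto_h1Dist_iff]
  constructor
  · have hw2 : MemLp w 2 (volume.restrict (openCell K)) := MemLp.of_eval_piLp fun i => (hw i).1
    have h1 : Tendsto (fun n => eLpNorm (fun x => (WithLp.toLp 2 fun i => v i n x : Space d) - w x) 2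
        (volume.restrict (openCell K)) ^ 2) atTop (𝓝 0) := by
      have e : ∀ n, eLpNorm (fun x => (WithLp.toLp 2 fun i => v i n x : Space d) - w x) 2
        (volume.restrict (openCell K)) ^ 2 = ∑ i, eLpNorm (fun x => v i n x - w x i) 2
          (volume.restrict (openCell K)) ^ 2 := fun n => by
        exact eLpNorm_two_sq_eq_sum ((hus n).continuous.aestronglyMeasurable.sub hw2.1)
      simp only [e]
      have h2 := tendsto_finsetSum Finset.univ fun i _ =>
        ((ENNReal.continuous_pow 2).tendsto _).comp (hv i)
      simpa [Function.comp_def] using h2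
    have h3 := ((ENNReal.continuous_rpow_const (y := (1 / 2 : ℝ))).tendsto _).comp h1
    have h4 : ∀ a : ℝ≥0∞, (a ^ 2) ^ (1 / 2 : ℝ) = a := fun a => by
      rw [← ENNReal.rpow_natCast, ← ENNReal.rpow_mul]
      simp
    simpa [Function.comp_def, -one_div, h4] using h3
  · intro i j
    refine (hvd i j).congr fun n => ?_
    refine eLpNorm_congr_ae (ae_of_all _ fun x => ?_)
    simp only
    rw [fderiv_apply_coord (hus n)]

variable {K F : Finset (Space d)}

namespace IsCell

lemma exists_erase [DecidableEq (Space d)] (hK : IsCell K) (hFK : F ⊆ K) (hF : F.card = d) :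
    ∃ p ∈ K, F = K.erase p := by
  obtain ⟨p, hp, h⟩ := Finset.exists_eq_insert_iff.2 ⟨hFK, by rw [hF, hK.card]⟩
  exact ⟨p, h ▸ Finset.mem_insert_self _ _, by rw [← h, Finset.erase_insert hp]⟩

lemma isFiniteMeasure_face (hd : 0 < d) (hK : IsCell K) (hFK : F ⊆ K) (hF : F.card = d) :
    IsFiniteMeasure (surfaceMeasure F) := by
  classical
  obtain ⟨p, hp, rfl⟩ := hK.exists_erase hFK hF
  exact hK.isFiniteMeasure_surfaceMeasure hd hp

/-- The trace inequality for the difference of two smooth fields close to `w`. -/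
lemma exists_trace_dist_le (hd : 0 < d) (hK : IsCell K) (hFK : F ⊆ K) (hF : F.card = d) :
    ∃ C : ℝ≥0∞, C ≠ ⊤ ∧ ∀ u u' w : Space d → Space d, ContDiff ℝ ∞ u → ContDiff ℝ ∞ u' →
      (∀ i, MemH1 (openCell K) fun x => w x i) →
      eLpNorm (fun x => u x - u' x) 2 (surfaceMeasure F) ≤ C * (h1Dist K u w + h1Dist K u' w) := by
  classical
  have hfin := hK.isFiniteMeasure_face hd hFK hF
  obtain ⟨p, hp, rfl⟩ := hK.exists_erase hFK hF
  obtain ⟨C, hC⟩ := hK.exists_trace_bound hd hp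
  set μ := (volume : Measure (Space d)).restrict (openCell K) with hμ
  -- The maximum with `1` ensures `B ≤ B ^ 2`, so the bound on squares can be compared with `(B * δ)
  -- ^ 2` without taking a square root of the constant.
  set B : ℝ≥0∞ := max 1 (ENNReal.ofReal C * (1 + d * d)) with hB
  refine ⟨B, by simp [hB, ENNReal.mul_eq_top], fun u u' w hu hu' hw => ?_⟩
  set δ := h1Dist K u w + h1Dist K u' w with hδ
  have hw2 : MemLp w 2 μ := MemLp.of_eval_piLp fun i => (hw i).1
  have hz : ContDiff ℝ ∞ fun x => u x - u' x := hu.sub hu'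
  have hzi : ∀ i, ContDiff ℝ ∞ fun x => (u x - u' x) i := fun i => contDiff_euclidean.1 hz i
  have h0 : eLpNorm (fun x => u x - u' x) 2 μ ≤ δ := by
    have e : (fun x => u x - u' x) = (fun x => u x - w x) - fun x => u' x - w x := by
      funext x
      simp
    rw [e]
    exact (eLpNorm_sub_le (hu.continuous.aestronglyMeasurable.sub hw2.1)
      (hu'.continuous.aestronglyMeasurable.sub hw2.1) (by norm_num)).trans
      (add_le_add le_self_add le_self_add)
  have h1 : ∀ i j, eLpNorm (fun x => fderiv ℝ (fun y => (u y - u' y) i) x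
      (EuclideanSpace.single j 1)) 2 μ ≤ δ := by
    intro i j
    have hg := ((hw i).weakPartial_spec j).1.1
    have e : (fun x => fderiv ℝ (fun y => (u y - u' y) i) x (EuclideanSpace.single j 1)) =
        (fun x => fderiv ℝ u x (EuclideanSpace.single j 1) i -
          weakPartial (openCell K) (fun y => w y i) j x) -
        fun x => fderiv ℝ u' x (EuclideanSpace.single j 1) i -
          weakPartial (openCell K) (fun y => w y i) j x := by
      funext x
      rw [← fderiv_apply_coord hz, fderiv_fun_sub (hu.differentiable (by simp) x)
        (hu'.differentiable (by simp) x)]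
      simp
    have hm : ∀ {z : Space d → Space d}, ContDiff ℝ ∞ z → AEStronglyMeasurable (fun x =>
        fderiv ℝ z x (EuclideanSpace.single j 1) i -
          weakPartial (openCell K) (fun y => w y i) j x) μ := fun hz' => by
      refine AEStronglyMeasurable.sub ?_ hg
      have h2 := hz'.continuous_fderiv (by simp)
      exact Continuous.aestronglyMeasurable (by fun_prop)
    have hle : ∀ z : Space d → Space d, eLpNorm (fun x =>
        fderiv ℝ z x (EuclideanSpace.single j 1) i -
          weakPartial (openCell K) (fun y => w y i) j x) 2 μ ≤ h1Dist K z w := fun z =>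
      ((Finset.single_le_sum (f := fun j => eLpNorm
        (fun x => fderiv ℝ z x (EuclideanSpace.single j 1) i -
          weakPartial (openCell K) (fun y => w y i) j x) 2 μ)
      (fun _ _ => zero_le) (Finset.mem_univ j)).trans
      (Finset.single_le_sum (f := fun i => ∑ j, eLpNorm
        (fun x => fderiv ℝ z x (EuclideanSpace.single j 1) i -
          weakPartial (openCell K) (fun y => w y i) j x) 2 μ)
      (fun _ _ => zero_le) (Finset.mem_univ i))).trans le_add_self
    rw [e]
    exact (eLpNorm_sub_le (hm hu) (hm hu') (by norm_num)).trans (add_le_add (hle u) (hle u'))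
  have h2 : eLpNorm (fun x => u x - u' x) 2 (surfaceMeasure (K.erase p)) ^ 2 ≤ (B * δ) ^ 2 := by
    rw [eLpNorm_two_sq_eq_sum hz.continuous.aestronglyMeasurable]
    calc _ ≤ ∑ i, ENNReal.ofReal C * (eLpNorm (fun x => (u x - u' x) i) 2 μ ^ 2 +
          ∑ j, eLpNorm (fun x => fderiv ℝ (fun y => (u y - u' y) i) x
            (EuclideanSpace.single j 1)) 2 μ ^ 2) :=
          Finset.sum_le_sum fun i _ => hC _ ((hzi i).of_le (by simp))
      _ = ENNReal.ofReal C * (eLpNorm (fun x => u x - u' x) 2 μ ^ 2 +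
          ∑ i, ∑ j, eLpNorm (fun x => fderiv ℝ (fun y => (u y - u' y) i) x
            (EuclideanSpace.single j 1)) 2 μ ^ 2) := by
          rw [← Finset.mul_sum, Finset.sum_add_distrib,
            ← eLpNorm_two_sq_eq_sum hz.continuous.aestronglyMeasurable]
      _ ≤ ENNReal.ofReal C * (δ ^ 2 + ∑ i : Fin d, ∑ j : Fin d, δ ^ 2) := by
          gcongr with i _ j _
          exact h1 i j
      _ = ENNReal.ofReal C * (1 + d * d) * δ ^ 2 := by
          simp only [Finset.sum_const, Finset.card_univ, Fintype.card_fin, nsmul_eq_mul]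
          ring
      _ ≤ B ^ 2 * δ ^ 2 := by
          gcongr
          rw [sq]
          exact le_trans (le_max_right _ _) (le_mul_of_one_le_left zero_le (le_max_left _ _))
      _ = (B * δ) ^ 2 := by ring
  exact (ENNReal.pow_le_pow_left_iff (by norm_num)).1 h2

/-- The filter is arbitrary because two cases are needed: `atTop` compares two approximating
sequences, and `atTop ×ˢ atTop` gives the Cauchy property of one. -/
lemma tendsto_trace_dist (hd : 0 < d) (hK : IsCell K) (hFK : F ⊆ K) (hF : F.card = d)
    {ι : Type*} {l : Filter ι} {u u' : ι → Space d → Space d} {w : Space d → Space d}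
    (hu : ∀ n, ContDiff ℝ ∞ (u n)) (hu' : ∀ n, ContDiff ℝ ∞ (u' n))
    (hw : ∀ i, MemH1 (openCell K) fun x => w x i)
    (h : Tendsto (fun n => h1Dist K (u n) w) l (𝓝 0))
    (h' : Tendsto (fun n => h1Dist K (u' n) w) l (𝓝 0)) :
    Tendsto (fun n => eLpNorm (fun x => u n x - u' n x) 2 (surfaceMeasure F)) l (𝓝 0) := by
  obtain ⟨C, hC, hle⟩ := hK.exists_trace_dist_le hd hFK hF
  refine tendsto_of_tendsto_of_tendsto_of_le_of_le tendsto_const_nhds ?_ (fun _ => zero_le)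
    fun n => hle (u n) (u' n) w (hu n) (hu' n) hw
  have := ENNReal.Tendsto.const_mul (a := C) (h.add h') (Or.inr hC)
  simpa using this

/-- All smooth approximations of `w` in `H¹(K)^d` have the same limit on the face. -/
lemma tendsto_of_hasTrace (hd : 0 < d) (hK : IsCell K) (hFK : F ⊆ K) (hF : F.card = d)
    {w : Space d → Space d} (hw : ∀ i, MemH1 (openCell K) fun x => w x i)
    {g : Lp (Space d) 2 (surfaceMeasure F)} (hg : HasTrace K F w g)
    {u : ℕ → Space d → Space d} (hu : ∀ n, ContDiff ℝ ∞ (u n))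
    (h : Tendsto (fun n => h1Dist K (u n) w) atTop (𝓝 0)) :
    Tendsto (fun n => eLpNorm (fun x => u n x - g x) 2 (surfaceMeasure F)) atTop (𝓝 0) := by
  obtain ⟨u', hu', h', hg'⟩ := hasTrace_iff.1 hg
  have h1 := (hK.tendsto_trace_dist hd hFK hF hu hu' hw h h').add hg'
  rw [add_zero] at h1
  refine tendsto_of_tendsto_of_tendsto_of_le_of_le tendsto_const_nhds h1 (fun _ => zero_le)
    fun n => ?_
  have e : (fun x => u n x - g x) = (fun x => u n x - u' n x) + fun x => u' n x - g x := by
    funext x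
    simp
  rw [e]
  exact eLpNorm_add_le ((hu n).continuous.aestronglyMeasurable.sub
    (hu' n).continuous.aestronglyMeasurable) ((hu' n).continuous.aestronglyMeasurable.sub
      (Lp.aestronglyMeasurable g)) (by norm_num)

lemma hasTrace_unique (hd : 0 < d) (hK : IsCell K) (hFK : F ⊆ K) (hF : F.card = d)
    {w : Space d → Space d} (hw : ∀ i, MemH1 (openCell K) fun x => w x i)
    {g g' : Lp (Space d) 2 (surfaceMeasure F)} (hg : HasTrace K F w g) (hg' : HasTrace K F w g') :
    g = g' := by
  have hfin := hK.isFiniteMeasure_face hd hFK hF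
  obtain ⟨u, hu, h, h1⟩ := hasTrace_iff.1 hg
  have h2 := hK.tendsto_of_hasTrace hd hFK hF hw hg' hu h
  have hm : ∀ n, MemLp (u n) 2 (surfaceMeasure F) := fun n => memLp_surfaceMeasure (hu n).continuous 2
  have e : ∀ g : Lp (Space d) 2 (surfaceMeasure F),
      Tendsto (fun n => eLpNorm (fun x => u n x - g x) 2 (surfaceMeasure F)) atTop (𝓝 0) →
      Tendsto (fun n => (hm n).toLp (u n)) atTop (𝓝 g) := fun g hg => by
    have := (Lp.tendsto_Lp_iff_tendsto_eLpNorm'' u hm g (Lp.memLp g)).2 hg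
    rwa [Lp.toLp_coeFn] at this
  exact tendsto_nhds_unique (e g h1) (e g' h2)

/-- The trace inequality makes the boundary values of a smooth approximating sequence Cauchy, and
`L²(F)` is complete. -/
lemma exists_hasTrace (hd : 0 < d) (hK : IsCell K) (hFK : F ⊆ K) (hF : F.card = d)
    {w : Space d → Space d} (hw : ∀ i, MemH1 (openCell K) fun x => w x i) :
    ∃ g : Lp (Space d) 2 (surfaceMeasure F), HasTrace K F w g := by
  have hfin := hK.isFiniteMeasure_face hd hFK hF
  obtain ⟨u, hu, h⟩ := exists_tendsto_h1Dist hw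
  have hm : ∀ n, MemLp (u n) 2 (surfaceMeasure F) := fun n => memLp_surfaceMeasure (hu n).continuous 2
  have hcauchy : CauchySeq fun n => (hm n).toLp (u n) := by
    rw [EMetric.cauchySeq_iff]
    intro ε hε
    have h1 := hK.tendsto_trace_dist hd hFK hF (l := atTop ×ˢ atTop)
      (u := fun n : ℕ × ℕ => u n.1) (u' := fun n => u n.2) (fun n => hu _) (fun n => hu _) hw
      (h.comp tendsto_fst) (h.comp tendsto_snd)
    have h2 := (h1.eventually (gt_mem_nhds hε))
    rw [prod_atTop_atTop_eq, eventually_atTop_prod_self] at h2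
    obtain ⟨N, hN⟩ := h2
    refine ⟨N, fun m hmN n hnN => ?_⟩
    rw [Lp.edist_toLp_toLp]
    exact hN m n hmN hnN
  obtain ⟨g, hg⟩ := cauchySeq_tendsto_of_complete hcauchy
  refine ⟨g, hasTrace_iff.2 ⟨u, hu, h, ?_⟩⟩
  rw [← Lp.toLp_coeFn g (Lp.memLp g)] at hg
  exact (Lp.tendsto_Lp_iff_tendsto_eLpNorm'' u hm g (Lp.memLp g)).1 hg

lemma hasTrace_trace (hd : 0 < d) (hK : IsCell K) (hFK : F ⊆ K) (hF : F.card = d)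
    {w : Space d → Space d} (hw : ∀ i, MemH1 (openCell K) fun x => w x i) :
    HasTrace K F w (trace K F w) := by
  have h := hK.exists_hasTrace hd hFK hF hw
  rw [trace, dif_pos h]
  exact h.choose_spec

end IsCell

/-! ### Linearity of weak derivatives and traces -/

lemma HasWeakPartial.add_smul {U : Set (Space d)} {f f' g g' h : Space d → ℝ} {j : Fin d}
    (hf : MemLp f 2 (volume.restrict U)) (hf' : MemLp f' 2 (volume.restrict U))
    (hg : MemLp g 2 (volume.restrict U)) (hg' : MemLp g' 2 (volume.restrict U))
    (hfg : HasWeakPartial U f j g) (hfg' : HasWeakPartial U f' j g') {c : ℝ}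
    (hh : h =ᵐ[volume.restrict U] fun x => f x + c * f' x) :
    HasWeakPartial U h j fun x => g x + c * g' x := by
  intro φ hφ hc hs
  have hφ2 := memLp_testFunction U hφ hc
  have hd2 := memLp_testFunction_fderiv U hφ hc (EuclideanSpace.single j 1)
  have e1 : ∫ x in U, h x * fderiv ℝ φ x (EuclideanSpace.single j 1) =
      ∫ x in U, (f x * fderiv ℝ φ x (EuclideanSpace.single j 1) +
        c * (f' x * fderiv ℝ φ x (EuclideanSpace.single j 1))) := by
    refine integral_congr_ae ?_
    filter_upwards [hh] with x hx
    rw [hx]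
    ring
  have e2 : ∫ x in U, (g x + c * g' x) * φ x = ∫ x in U, (g x * φ x + c * (g' x * φ x)) := by
    congr 1
    funext x
    ring
  have hi : ∀ {a b : Space d → ℝ}, MemLp a 2 (volume.restrict U) → MemLp b 2 (volume.restrict U) →
      Integrable (fun x => a x * b x) (volume.restrict U) := fun ha hb => ha.integrable_mul hb
  rw [e1, e2, integral_add (hi hf hd2) ((hi hf' hd2).const_mul c),
    integral_add (hi hg hφ2) ((hi hg' hφ2).const_mul c),
    integral_const_mul, integral_const_mul, hfg φ hφ hc hs, hfg' φ hφ hc hs]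
  ring

lemma weakPartial_add_smul {U : Set (Space d)} (hU : IsOpen U) {f f' h : Space d → ℝ}
    (hf : MemH1 U f) (hf' : MemH1 U f') {c : ℝ}
    (hh : h =ᵐ[volume.restrict U] fun x => f x + c * f' x) (j : Fin d) :
    weakPartial U h j =ᵐ[volume.restrict U]
      fun x => weakPartial U f j x + c * weakPartial U f' j x := by
  have hh1 : MemH1 U h := (hf.add (hf'.const_mul c)).congr hh.symm
  obtain ⟨h1, h2⟩ := hh1.weakPartial_spec j
  obtain ⟨h3, h4⟩ := hf.weakPartial_spec j
  obtain ⟨h5, h6⟩ := hf'.weakPartial_spec j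
  exact h2.ae_unique hU h1 (h3.add (h5.const_mul c)) (h4.add_smul hf.1 hf'.1 h3 h5 h6 hh)

lemma tendsto_eLpNorm_add_smul {α E : Type*} [MeasurableSpace α] [NormedAddCommGroup E]
    [NormedSpace ℝ E] {μ : Measure α} {f f' : ℕ → α → E} (hf : ∀ n, AEStronglyMeasurable (f n) μ)
    (hf' : ∀ n, AEStronglyMeasurable (f' n) μ) (c : ℝ)
    (h : Tendsto (fun n => eLpNorm (f n) 2 μ) atTop (𝓝 0))
    (h' : Tendsto (fun n => eLpNorm (f' n) 2 μ) atTop (𝓝 0)) :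
    Tendsto (fun n => eLpNorm (f n + c • f' n) 2 μ) atTop (𝓝 0) := by
  have h1 := h.add (ENNReal.Tendsto.const_mul (a := ‖c‖ₑ) h' (Or.inr (by simp)))
  rw [mul_zero, add_zero] at h1
  refine tendsto_of_tendsto_of_tendsto_of_le_of_le tendsto_const_nhds h1 (fun _ => zero_le)
    fun n => ?_
  refine (eLpNorm_add_le (hf n) ((hf' n).const_smul c) (by norm_num)).trans ?_
  rw [eLpNorm_const_smul]

/-- The trace operator is linear. -/
lemma HasTrace.add_smul {v w z : Space d → Space d} {g h : Lp (Space d) 2 (surfaceMeasure F)}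
    (hv : ∀ i, MemH1 (openCell K) fun x => v x i) (hw : ∀ i, MemH1 (openCell K) fun x => w x i)
    (hg : HasTrace K F v g) (hh : HasTrace K F w h) {c : ℝ}
    (hz : z =ᵐ[volume.restrict (openCell K)] fun x => v x + c • w x) :
    HasTrace K F z (g + c • h) := by
  obtain ⟨u, hu, hu1, hu2, hu3⟩ := hg
  obtain ⟨u', hu', hu1', hu2', hu3'⟩ := hh
  have hv2 : MemLp v 2 (volume.restrict (openCell K)) := MemLp.of_eval_piLp fun i => (hv i).1
  have hw2 : MemLp w 2 (volume.restrict (openCell K)) := MemLp.of_eval_piLp fun i => (hw i).1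
  refine ⟨fun n x => u n x + c • u' n x, fun n => (hu n).add ((hu' n).const_smul c), ?_,
    fun i j => ?_, ?_⟩
  · refine (tendsto_eLpNorm_add_smul
      (fun n => (hu n).continuous.aestronglyMeasurable.sub hv2.1)
      (fun n => (hu' n).continuous.aestronglyMeasurable.sub hw2.1) c hu1 hu1').congr fun n => ?_
    refine eLpNorm_congr_ae ?_
    filter_upwards [hz] with x hx
    show (u n x - v x) + c • (u' n x - w x) = u n x + c • u' n x - z x
    rw [hx, smul_sub]
    abel
  · have hm : ∀ {y y' : Space d → Space d}, ContDiff ℝ ∞ y →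
        (MemH1 (openCell K) fun x => y' x i) → AEStronglyMeasurable (fun x =>
        fderiv ℝ y x (EuclideanSpace.single j 1) i -
          weakPartial (openCell K) (fun q => y' q i) j x) (volume.restrict (openCell K)) :=
      fun hy hy' => by
        refine AEStronglyMeasurable.sub ?_ (hy'.weakPartial_spec j).1.1
        have h2 := hy.continuous_fderiv (by simp)
        exact Continuous.aestronglyMeasurable (by fun_prop)
    refine (tendsto_eLpNorm_add_smul (fun n => hm (hu n) (hv i)) (fun n => hm (hu' n) (hw i)) c
      (hu2 i j) (hu2' i j)).congr fun n => ?_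
    have hzi : (fun x => z x i) =ᵐ[volume.restrict (openCell K)] fun x => v x i + c * w x i := by
      filter_upwards [hz] with x hx
      rw [hx]
      rfl
    refine eLpNorm_congr_ae ?_
    filter_upwards [weakPartial_add_smul isOpen_interior (hv i) (hw i) hzi j] with x hx
    have hx' : weakPartial (openCell K) (fun y => z y i) j x = _ := hx
    have hd := (((hu n).differentiable (by simp) x).hasFDerivAt.add
      (((hu' n).differentiable (by simp) x).hasFDerivAt.const_smul c)).fderiv
    have hd' : fderiv ℝ (fun x => u n x + c • u' n x) x = _ := hd
    rw [hx', hd']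
    simp only [Pi.add_apply, Pi.smul_apply, smul_eq_mul, _root_.add_apply, _root_.smul_apply,
      PiLp.add_apply, PiLp.smul_apply, openCell]
    ring
  · refine (tendsto_eLpNorm_add_smul
      (fun n => (hu n).continuous.aestronglyMeasurable.sub (Lp.aestronglyMeasurable g))
      (fun n => (hu' n).continuous.aestronglyMeasurable.sub (Lp.aestronglyMeasurable h)) c
      hu3 hu3').congr fun n => ?_
    refine eLpNorm_congr_ae ?_
    filter_upwards [Lp.coeFn_add g (c • h), Lp.coeFn_smul c h] with x hx hx'
    rw [hx]
    simp only [Pi.add_apply, hx', Pi.smul_apply, smul_sub, Pi.sub_apply]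
    abel

end BrokenSobolev
end

noncomputable section

namespace BrokenSobolev

variable {d : ℕ}

open Metric Set
open scoped RealInnerProductSpace

/-! ### Green's formula on an element -/

lemma tendsto_integral_mul_of_eLpNorm_two {α : Type*} [MeasurableSpace α] {μ : Measure α}
    {f : ℕ → α → ℝ} {g φ : α → ℝ} (hf : ∀ n, MemLp (f n) 2 μ) (hg : MemLp g 2 μ)
    (hφ : MemLp φ 2 μ) (h : Tendsto (fun n => eLpNorm (fun x => f n x - g x) 2 μ) atTop (𝓝 0)) :
    Tendsto (fun n => ∫ x, f n x * φ x ∂μ) atTop (𝓝 (∫ x, g x * φ x ∂μ)) := by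
  have hi : ∀ {a b : α → ℝ}, MemLp a 2 μ → MemLp b 2 μ → Integrable (fun x => a x * b x) μ :=
    fun ha hb => ha.integrable_mul hb
  refine tendsto_integral_of_L1 _ (hi hg hφ).1
    (Eventually.of_forall fun n => hi (hf n) hφ) ?_
  have h1 := ENNReal.Tendsto.mul_const (b := eLpNorm φ 2 μ) h (Or.inr hφ.2.ne)
  rw [zero_mul] at h1
  refine tendsto_of_tendsto_of_tendsto_of_le_of_le tendsto_const_nhds h1 (fun _ => zero_le)
    fun n => ?_
  have h2 := eLpNorm_smul_le_mul_eLpNorm (p := 2) (q := 2) (r := 1) hφ.1 ((hf n).1.sub hg.1)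
  rw [eLpNorm_one_eq_lintegral_enorm] at h2
  refine le_trans (le_of_eq (lintegral_congr fun x => ?_)) h2
  simp [sub_mul]

lemma eLpNorm_apply_le {α : Type*} [MeasurableSpace α] {μ : Measure α} {f : α → Space d}
    (i : Fin d) : eLpNorm (fun x => f x i) 2 μ ≤ eLpNorm f 2 μ :=
  eLpNorm_mono fun x => PiLp.norm_apply_le (f x) i

/-- Both sides are continuous along smooth approximations of `w` in `H¹(K)`, the right one by the
trace inequality, so the formula for smooth fields passes to the limit. The test function need not
vanish on the boundary of `K`; this is what produces the face terms. -/
lemma IsCell.integral_mul_fderiv_add (hd : 0 < d) [DecidableEq (Space d)] {K : Finset (Space d)}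
    (hK : IsCell K) {w : Space d → Space d} (hw : ∀ i, MemH1 (openCell K) fun x => w x i)
    {φ : Space d → ℝ} (hφ : ContDiff ℝ ∞ φ) (i j : Fin d) :
    (∫ x in openCell K, w x i * fderiv ℝ φ x (EuclideanSpace.single j 1)) +
      ∫ x in openCell K, weakPartial (openCell K) (fun y => w y i) j x * φ x =
    ∑ p ∈ K, (SignType.sign (side K (K.erase p)) : ℝ) *
      ⟪faceNormal (K.erase p), EuclideanSpace.single j 1⟫ *
        ∫ y, (trace K (K.erase p) w : Space d → Space d) y i * φ y
          ∂(surfaceMeasure (K.erase p)) := by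
  obtain ⟨u, hu, h⟩ := exists_tendsto_h1Dist hw
  obtain ⟨h1, h2⟩ := tendsto_h1Dist_iff.1 h
  have hui : ∀ n, ContDiff ℝ ∞ fun x => u n x i := fun n => contDiff_euclidean.1 (hu n) i
  have hderc : ∀ n, Continuous fun x => fderiv ℝ (fun y => u n y i) x (EuclideanSpace.single j 1) :=
    fun n => ((hui n).continuous_fderiv (by simp)).clm_apply continuous_const
  have hφc : Continuous fun x => fderiv ℝ φ x (EuclideanSpace.single j 1) :=
    (hφ.continuous_fderiv (by simp)).clm_apply continuous_const
  have hmem : ∀ {g : Space d → ℝ}, Continuous g → MemLp g 2 (volume.restrict (openCell K)) :=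
    fun hg => by
      rw [memLp_two_iff_integrable_sq hg.aestronglyMeasurable]
      exact integrable_openCell (hg.pow 2) K
  have hgreen : ∀ n, (∫ x in openCell K, u n x i * fderiv ℝ φ x (EuclideanSpace.single j 1)) +
      ∫ x in openCell K, fderiv ℝ (u n) x (EuclideanSpace.single j 1) i * φ x =
      ∑ p ∈ K, (SignType.sign (side K (K.erase p)) : ℝ) *
        ⟪faceNormal (K.erase p), EuclideanSpace.single j 1⟫ *
          ∫ y, u n y i * φ y ∂(surfaceMeasure (K.erase p)) := by
    intro n
    rw [← hK.integral_fderiv hd (((hui n).mul hφ).of_le (by simp)), ← integral_add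
      (f := fun x => u n x i * fderiv ℝ φ x (EuclideanSpace.single j 1))
      (integrable_openCell ((hui n).continuous.mul hφc) K)]
    · congr 1
      funext x
      rw [fderiv_apply_coord (hu n)]
      have : fderiv ℝ (fun x => u n x i * φ x) x = _ :=
        (((hui n).differentiable (by simp) x).hasFDerivAt.mul
        (hφ.differentiable (by simp) x).hasFDerivAt).fderiv
      rw [this]
      simp only [_root_.add_apply, _root_.smul_apply, smul_eq_mul]
      ring
    · simp only [fderiv_apply_coord (hu n)]
      exact integrable_openCell ((hderc n).mul hφ.continuous) K
  have hl1 := tendsto_integral_mul_of_eLpNorm_two (fun n => hmem (hui n).continuous) (hw i).1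
    (hmem hφc) (tendsto_of_tendsto_of_tendsto_of_le_of_le tendsto_const_nhds h1 (fun _ => zero_le)
      fun n => eLpNorm_apply_le (f := fun x => u n x - w x) i)
  have hl2 := tendsto_integral_mul_of_eLpNorm_two (fun n => by
    simp only [fderiv_apply_coord (hu n)]
    exact hmem (hderc n)) ((hw i).weakPartial_spec j).1 (hmem hφ.continuous) (h2 i j)
  refine tendsto_nhds_unique ((hl1.add hl2).congr hgreen) ?_
  refine tendsto_finsetSum _ fun p hp => Tendsto.const_mul _ ?_
  have hfin := hK.isFiniteMeasure_surfaceMeasure hd hp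
  have htr := hK.tendsto_of_hasTrace hd (K.erase_subset p) (hK.card_erase hp) hw
    (hK.hasTrace_trace hd (K.erase_subset p) (hK.card_erase hp) hw) hu h
  exact tendsto_integral_mul_of_eLpNorm_two
    (fun n => memLp_surfaceMeasure (hui n).continuous 2)
    ((Lp.memLp (trace K (K.erase p) w)).eval_piLp i)
    (memLp_surfaceMeasure hφ.continuous 2)
    (tendsto_of_tendsto_of_tendsto_of_le_of_le tendsto_const_nhds htr (fun _ => zero_le)
      fun n => eLpNorm_apply_le (f := fun x => u n x - trace K (K.erase p) w x) i)

/-! ### Geometry of the mesh -/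

namespace SimplicialMesh

variable {T : SimplicialMesh d} {K K' F : Finset (Space d)}

lemma mem_elements : K ∈ T.elements ↔ K ∈ T.faces ∧ K.card = d + 1 := by
  simp [elements]

lemma mem_meshFaces : F ∈ T.meshFaces ↔ F ∈ T.faces ∧ F.card = d := by
  simp [meshFaces]

lemma isCell (hK : K ∈ T.elements) : IsCell K :=
  ⟨(mem_elements.1 hK).2, T.indep (mem_elements.1 hK).1⟩

/-- Two elements sharing a face lie on opposite sides of it. -/
lemma sign_side_eq_neg (hd : 0 < d) (hK : K ∈ T.elements) (hK' : K' ∈ T.elements) (hne : K ≠ K')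
    (hFK : F ⊆ K) (hFK' : F ⊆ K') (hF : F.card = d) :
    SignType.sign (side K' F) = - SignType.sign (side K F) := by
  classical
  have hc := isCell hK
  have hc' := isCell hK'
  obtain ⟨p, hp, hFp⟩ := hc.exists_erase hFK hF
  obtain ⟨q, hq, hFq⟩ := hc'.exists_erase hFK' hF
  have hs : side K F ≠ 0 := hFp ▸ hc.side_erase_ne_zero hd hp
  have hs' : side K' F ≠ 0 := hFq ▸ hc'.side_erase_ne_zero hd hq
  have hsp : side K F = faceOffset F - ⟪faceNormal F, p⟫ := by
    have := hc.side_erase hp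
    rwa [← hFp] at this
  have hsq : side K' F = faceOffset F - ⟪faceNormal F, q⟫ := by
    have := hc'.side_erase hq
    rwa [← hFq] at this
  by_contra hsign
  -- If both opposite vertices lay on the same side, a short step from the barycentre `c` of `F`
  -- towards `q` would stay in both elements. Conformity would place the resulting point in the hull
  -- of `F`, although it is off the hyperplane of `F`.
  have hpos : 0 < side K' F / side K F := by
    rcases lt_or_gt_of_ne hs with h | h <;> rcases lt_or_gt_of_ne hs' with h' | h'
    · exact div_pos_of_neg_of_neg h' h
    · exact absurd (by rw [sign_neg h, sign_pos h']; rfl) hsign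
    · exact absurd (by rw [sign_pos h, sign_neg h']) hsign
    · exact div_pos h' h
  have hd' : (0 : ℝ) < d := by exact_mod_cast hd
  set c : Space d := ∑ v ∈ F, (1 / (d : ℝ)) • v with hcdef
  have hsum1 : ∑ v ∈ F, (1 / (d : ℝ)) = 1 := by
    rw [Finset.sum_const, hF, nsmul_eq_mul, mul_one_div_cancel hd'.ne']
  have hcF : c ∈ convexHull ℝ (F : Set (Space d)) :=
    Finset.mem_convexHull'.2 ⟨fun _ => 1 / d, fun _ _ => by positivity, hsum1, rfl⟩
  obtain ⟨α, hα0, hα⟩ := hc.exists_weights (q - c)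
  have hpF : p ∉ F := by rw [hFp]; exact Finset.notMem_erase _ _
  have hKF : ∀ g : Space d → ℝ, ∑ v ∈ K, g v = g p + ∑ v ∈ F, g v := fun g => by
    rw [← Finset.add_sum_erase K g hp, ← hFp]
  have hKFv : ∀ g : Space d → Space d, ∑ v ∈ K, g v = g p + ∑ v ∈ F, g v := fun g => by
    rw [← Finset.add_sum_erase K g hp, ← hFp]
  have hnc : ⟪faceNormal F, c⟫ = faceOffset F := inner_faceNormal_of_mem_convexHull hF.le hcF
  -- Comparing normal components shows that the weight of `p` in `q - c` is the ratio of the two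
  -- signed heights.
  have hαp : 0 < α p := by
    have h1 : ⟪faceNormal F, q - c⟫ = α p * ⟪faceNormal F, p⟫ - α p * faceOffset F := by
      rw [← hα, inner_sum]
      simp only [inner_smul_right]
      rw [hKF, Finset.sum_congr rfl fun v hv => by rw [inner_faceNormal hF.le hv],
        ← Finset.sum_mul]
      rw [hKF] at hα0
      rw [show ∑ v ∈ F, α v = - α p by linarith]
      ring
    rw [inner_sub_right, hnc] at h1
    have h2 : α p = side K' F / side K F := by
      rw [eq_div_iff hs, hsp, hsq]
      linarith
    rw [h2]
    exact hpos
  set S := ∑ v ∈ F, |α v| with hS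
  have hS0 : 0 ≤ S := Finset.sum_nonneg fun _ _ => abs_nonneg _
  -- This gives `ε * S ≤ 1 / d`, so no barycentric weight `1 / d + ε * α v` becomes negative.
  set ε : ℝ := 1 / (1 + d * S) with hε
  have hε0 : 0 < ε := by positivity
  have hε1 : ε ≤ 1 := by
    rw [hε, div_le_one (by positivity)]
    nlinarith
  set x : Space d := c + ε • (q - c) with hx
  have hxK : x ∈ convexHull ℝ (K : Set (Space d)) := by
    refine Finset.mem_convexHull'.2 ⟨fun v => (if v = p then (0 : ℝ) else 1 / (d : ℝ)) + ε * α v, ?_, ?_, ?_⟩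
    · intro v hv
      by_cases hvp : v = p
      · subst hvp
        simp only [if_true, zero_add]
        positivity
      · simp only [if_neg hvp]
        have hvF : v ∈ F := by rw [hFp]; exact Finset.mem_erase.2 ⟨hvp, hv⟩
        have h1 : |α v| ≤ S := Finset.single_le_sum (f := fun v => |α v|)
          (fun _ _ => abs_nonneg _) hvF
        have h2 : ε * S ≤ 1 / d := by
          rw [hε, one_div_mul_eq_div, div_le_div_iff₀ (by positivity) hd']
          nlinarith
        have h3 : -(ε * S) ≤ ε * α v := by
          have := neg_abs_le (α v)
          nlinarith
        linarith
    · rw [Finset.sum_add_distrib, ← Finset.mul_sum, hα0, mul_zero, add_zero, hKF, if_pos rfl,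
        zero_add, Finset.sum_congr rfl fun v hv => by
          rw [if_neg (fun h : v = p => hpF (h ▸ hv))], hsum1]
    · simp only [add_smul, mul_smul]
      rw [Finset.sum_add_distrib, ← Finset.smul_sum, hα, hKFv, if_pos rfl, zero_smul, zero_add,
        Finset.sum_congr rfl fun v hv => by
          rw [if_neg (fun h : v = p => hpF (h ▸ hv))]]
  have hxK' : x ∈ convexHull ℝ (K' : Set (Space d)) := by
    have hcK' : c ∈ convexHull ℝ (K' : Set (Space d)) :=
      convexHull_mono (by exact_mod_cast hFK') hcF
    have hqK' : q ∈ convexHull ℝ (K' : Set (Space d)) := subset_convexHull ℝ _ (by exact_mod_cast hq)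
    exact (convex_convexHull ℝ _).add_smul_sub_mem hcK' hqK' ⟨hε0.le, hε1⟩
  have hpq : p ≠ q := by
    rintro rfl
    apply hne
    rw [← Finset.insert_erase hp, ← Finset.insert_erase hq, ← hFp, ← hFq]
  have hinter : (K ∩ K' : Set (Space d)) ⊆ F := by
    rintro v ⟨hv, hv'⟩
    by_contra hvF
    have e1 : v = p := by
      by_contra h
      exact hvF (by rw [hFp]; exact Finset.mem_erase.2 ⟨h, hv⟩)
    have e2 : v = q := by
      by_contra h
      exact hvF (by rw [hFq]; exact Finset.mem_erase.2 ⟨h, hv'⟩)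
    exact hpq (e1.symm.trans e2)
  have hxF := convexHull_mono hinter (T.inter_subset_convexHull (mem_elements.1 hK).1
    (mem_elements.1 hK').1 ⟨hxK, hxK'⟩)
  have hxn := inner_faceNormal_of_mem_convexHull hF.le hxF
  rw [hx, inner_add_right, inner_smul_right, inner_sub_right, hnc] at hxn
  have : ε * side K' F = 0 := by rw [hsq]; linarith
  exact hs' ((mul_eq_zero.1 this).resolve_left hε0.ne')

/-- Distinct elements share at most `d` vertices, so by conformity their intersection lies in a
hyperplane. A nonempty open set cannot: it can be left along the normal. -/
lemma disjoint_openCell (hK : K ∈ T.elements) (hK' : K' ∈ T.elements) (hne : K ≠ K') :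
    Disjoint (openCell K) (openCell K') := by
  classical
  rw [Set.disjoint_iff]
  rintro x ⟨hx, hx'⟩
  have hcard : (K ∩ K').card ≤ d := by
    have h1 : (K ∩ K').card < K.card := by
      refine Finset.card_lt_card (Finset.ssubset_iff_subset_ne.2 ⟨Finset.inter_subset_left, ?_⟩)
      intro h
      refine hne (Finset.eq_of_subset_of_card_le (Finset.inter_eq_left.1 h) ?_)
      rw [(mem_elements.1 hK).2, (mem_elements.1 hK').2]
    rw [(mem_elements.1 hK).2] at h1
    omega
  have hsub : ∀ y ∈ openCell K ∩ openCell K', y ∈ convexHull ℝ ((K ∩ K' : Finset (Space d)) : Set (Space d)) := by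
    rintro y ⟨hy, hy'⟩
    rw [Finset.coe_inter]
    exact T.inter_subset_convexHull (mem_elements.1 hK).1 (mem_elements.1 hK').1
      ⟨interior_subset hy, interior_subset hy'⟩
  have hne' : (K ∩ K').Nonempty := by
    have h1 : (convexHull ℝ ((K ∩ K' : Finset (Space d)) : Set (Space d))).Nonempty :=
      ⟨x, hsub x ⟨hx, hx'⟩⟩
    exact_mod_cast convexHull_nonempty_iff.1 h1
  have hopen : IsOpen (openCell K ∩ openCell K') := isOpen_interior.inter isOpen_interior
  have hcont : Tendsto (fun t : ℝ => x + t • faceNormal (K ∩ K')) (𝓝[≠] 0) (𝓝 x) := by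
    have : Continuous fun t : ℝ => x + t • faceNormal (K ∩ K') := by fun_prop
    have h2 := this.tendsto 0
    simp only [zero_smul, add_zero] at h2
    exact h2.mono_left nhdsWithin_le_nhds
  obtain ⟨t, ht, ht0⟩ := ((hcont.eventually (hopen.mem_nhds ⟨hx, hx'⟩)).and
    self_mem_nhdsWithin).exists
  have h1 := inner_faceNormal_of_mem_convexHull hcard (hsub _ ht)
  have h2 := inner_faceNormal_of_mem_convexHull hcard (hsub _ ⟨hx, hx'⟩)
  rw [inner_add_right, h2, inner_smul_right, real_inner_self_eq_norm_sq,
    norm_faceNormal hcard hne'] at h1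
  exact ht0 (by simpa using h1)

/-- By `pure_dim` each point of the domain lies in a closed element. The points missed by the open
cells lie on finitely many frontiers of convex sets, which are null. -/
lemma iUnion_openCell_ae_eq_domain (T : SimplicialMesh d) :
    (⋃ K ∈ T.elements, openCell K) =ᵐ[volume] T.domain := by
  have h1 : (⋃ K ∈ T.elements, openCell K) ⊆ T.domain :=
    iUnion₂_subset fun K hK => T.openCell_subset_domain hK
  refine Filter.EventuallyLE.antisymm (ae_of_all _ h1) ?_
  have h2 : T.domain ⊆ (⋃ K ∈ T.elements, openCell K) ∪
      ⋃ K ∈ T.elements, frontier (convexHull ℝ (K : Set (Space d))) := by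
    intro x hx
    obtain ⟨s, hs, hxs⟩ := Geometry.SimplicialComplex.mem_space_iff.1 (interior_subset hx)
    obtain ⟨K, hK, hsK, hKc⟩ := T.pure_dim s hs
    have hKe : K ∈ T.elements := mem_elements.2 ⟨hK, hKc⟩
    have hxK : x ∈ convexHull ℝ (K : Set (Space d)) := convexHull_mono (by exact_mod_cast hsK) hxs
    by_cases hi : x ∈ openCell K
    · exact Or.inl (mem_biUnion hKe hi)
    · exact Or.inr (mem_biUnion hKe ⟨subset_closure hxK, hi⟩)
  have h3 : volume (⋃ K ∈ T.elements, frontier (convexHull ℝ (K : Set (Space d)))) = 0 :=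
    (measure_biUnion_null_iff T.elements.countable_toSet).2 fun K _ =>
      (convex_convexHull ℝ _).addHaar_frontier volume
  filter_upwards [compl_mem_ae_iff.2 h3] with x hx hxd
  exact (h2 hxd).resolve_right hx

lemma setIntegral_domain {f : Space d → ℝ} (hf : IntegrableOn f T.domain) :
    ∫ x in T.domain, f x = ∑ K ∈ T.elements, ∫ x in openCell K, f x := by
  rw [← setIntegral_congr_set (iUnion_openCell_ae_eq_domain T)]
  exact integral_biUnion_finset _ (fun K _ => isOpen_interior.measurableSet)
    (fun K hK K' hK' hne => disjoint_openCell hK hK' hne)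
    (fun K hK => hf.mono_set (T.openCell_subset_domain hK))

/-! ### Linearity and integrability of the broken quantities -/

lemma memH1_field (w : T.brokenH1) (hK : K ∈ T.elements) (i : Fin d) :
    MemH1 (openCell K) fun x => field w x i := w.2 K hK i

lemma memLp_field (w : T.brokenH1) : MemLp (field w) 2 (volume.restrict T.domain) :=
  Lp.memLp (w : Lp (Space d) 2 (volume.restrict T.domain))

lemma field_add_smul (v w : T.brokenH1) (c : ℝ) :
    field (v + c • w) =ᵐ[volume.restrict T.domain] fun x => field v x + c • field w x := by
  filter_upwards [Lp.coeFn_add (v : Lp (Space d) 2 (volume.restrict T.domain))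
    (c • (w : Lp (Space d) 2 (volume.restrict T.domain))),
    Lp.coeFn_smul c (w : Lp (Space d) 2 (volume.restrict T.domain))] with x hx hx'
  have h1 : field (v + c • w) x = _ := hx
  rw [h1, Pi.add_apply, hx']
  rfl

lemma field_add_smul_openCell (v w : T.brokenH1) (c : ℝ) (hK : K ∈ T.elements) :
    field (v + c • w) =ᵐ[volume.restrict (openCell K)] fun x => field v x + c • field w x :=
  ae_restrict_of_ae_restrict_of_subset (T.openCell_subset_domain hK) (field_add_smul v w c)

/-- `trace` is a choice, so linearity comes from uniqueness: the combination of the traces is itself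
a trace of the combined field. -/
lemma trace_add_smul (hd : 0 < d) (v w : T.brokenH1) (c : ℝ) (hK : K ∈ T.elements) (hFK : F ⊆ K)
    (hF : F.card = d) : trace K F (field (v + c • w)) =
      trace K F (field v) + c • trace K F (field w) := by
  have hc := isCell hK
  have ht : ∀ z : T.brokenH1, HasTrace K F (field z) (trace K F (field z)) := fun z =>
    hc.hasTrace_trace hd hFK hF (memH1_field z hK)
  exact hc.hasTrace_unique hd hFK hF (memH1_field _ hK) (ht _)
    ((ht v).add_smul (memH1_field v hK) (memH1_field w hK) (ht w)
      (field_add_smul_openCell v w c hK))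

lemma jump_add_smul (hd : 0 < d) (σ : T.Orientation) (v w : T.brokenH1) (c : ℝ)
    (hF : F ∈ T.meshFaces) : jump σ (field (v + c • w)) F =
      jump σ (field v) F + c • jump σ (field w) F := by
  have hFd := (mem_meshFaces.1 hF).2
  rw [jump, jump, jump, trace_add_smul hd v w c (σ.plus_mem F hF) (σ.subset_plus F hF) hFd,
    Finset.sum_congr rfl fun K hK => trace_add_smul hd v w c (Finset.mem_filter.1 hK).1
      (Finset.mem_filter.1 hK).2.1 hFd, Finset.sum_add_distrib, ← Finset.smul_sum, smul_sub]
  abel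

lemma brokenGrad_add_smul (v w : T.brokenH1) (c : ℝ) : ∀ᵐ x, T.brokenGrad (field (v + c • w)) x =
    T.brokenGrad (field v) x + c • T.brokenGrad (field w) x := by
  have h : ∀ᵐ x : Space d, ∀ K ∈ T.elements, ∀ i j, x ∈ openCell K →
      weakPartial (openCell K) (fun y => field (v + c • w) y i) j x =
        weakPartial (openCell K) (fun y => field v y i) j x +
          c * weakPartial (openCell K) (fun y => field w y i) j x := by
    rw [eventually_all_finset]
    intro K hK
    rw [eventually_all]
    intro i
    rw [eventually_all]
    intro j
    refine (ae_restrict_iff' (s := openCell K) isOpen_interior.measurableSet).1 ?_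
    refine weakPartial_add_smul isOpen_interior (memH1_field v hK i) (memH1_field w hK i) ?_ j
    filter_upwards [field_add_smul_openCell v w c hK] with x hx
    rw [hx]
    rfl
  filter_upwards [h] with x hx
  ext i j
  simp only [brokenGrad, Matrix.of_apply, Matrix.add_apply, Matrix.smul_apply, smul_eq_mul,
    Finset.mul_sum]
  rw [← Finset.sum_add_distrib]
  refine Finset.sum_congr rfl fun K hK => ?_
  by_cases hxK : x ∈ openCell K
  · simp only [indicator_of_mem hxK, hx K hK i j hxK]
  · simp [indicator_of_notMem hxK]

lemma stress_add_smul (v w : T.brokenH1) (c : ℝ) : ∀ᵐ x, T.stress (field (v + c • w)) x =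
    T.stress (field v) x + c • T.stress (field w) x := by
  filter_upwards [brokenGrad_add_smul v w c] with x hx
  ext i j
  simp only [stress, hx, Matrix.transpose_add, Matrix.transpose_smul, Matrix.trace_add,
    Matrix.trace_smul, Matrix.sub_apply, Matrix.add_apply, Matrix.smul_apply, smul_eq_mul]
  ring

lemma memLp_brokenGrad (w : T.brokenH1) (i j : Fin d) :
    MemLp (fun x => T.brokenGrad (field w) x i j) 2 volume := by
  simp only [brokenGrad, Matrix.of_apply]
  refine memLp_finsetSum _ fun K hK => ?_
  exact (memLp_indicator_iff_restrict isOpen_interior.measurableSet).2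
    ((memH1_field w hK i).weakPartial_spec j).1

lemma stress_apply (w : Space d → Space d) (x : Space d) (i j : Fin d) :
    T.stress w x i j = T.brokenGrad w x i j + T.brokenGrad w x j i -
      if i = j then (2 / 3) * ∑ k, T.brokenGrad w x k k else 0 := by
  simp only [stress, Matrix.sub_apply, Matrix.add_apply, Matrix.transpose_apply, Matrix.smul_apply,
    Matrix.one_apply, Matrix.trace, Matrix.diag_apply, smul_eq_mul, mul_ite, mul_one, mul_zero]

lemma memLp_stress (w : T.brokenH1) (i j : Fin d) :
    MemLp (fun x => T.stress (field w) x i j) 2 volume := by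
  simp only [stress_apply]
  refine ((memLp_brokenGrad w i j).add (memLp_brokenGrad w j i)).sub ?_
  split_ifs
  · exact (memLp_finsetSum _ fun k _ => memLp_brokenGrad w k k).const_mul _
  · exact MemLp.zero'

/-! ### Homogeneity and the triangle inequality -/

/-- The norms of the entries of the stress in `L²(Ω)` and the weighted norms of the jumps. -/
def normPart (σ : T.Orientation) (w : T.brokenH1) : (Fin d × Fin d) ⊕ Finset (Space d) → ℝ :=
  Sum.elim (fun q => (eLpNorm (fun x => T.stress (field w) x q.1 q.2) 2
      (volume.restrict T.domain)).toReal)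
    fun F => √(faceDiam F)⁻¹ * ‖jump σ (field w) F‖

/-- The indices of the parts of the norm. -/
def parts (T : SimplicialMesh d) : Finset ((Fin d × Fin d) ⊕ Finset (Space d)) :=
  Finset.univ.disjSum T.meshFaces

lemma normPart_nonneg (σ : T.Orientation) (w : T.brokenH1) (k) : 0 ≤ normPart σ w k := by
  rcases k with q | F
  · exact ENNReal.toReal_nonneg
  · exact mul_nonneg (Real.sqrt_nonneg _) (norm_nonneg _)

/-- With the weights absorbed as square roots, the norm is the Euclidean norm of a finite vector of
seminorms. Homogeneity can then be checked componentwise, and the triangle inequality reduces to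
Minkowski's inequality for finite sums. -/
lemma symNorm_eq (σ : T.Orientation) (w : T.brokenH1) :
    symNorm σ w = √(∑ k ∈ parts T, normPart σ w k ^ 2) := by
  rw [symNorm, parts, Finset.sum_disjSum]
  congr 2
  · have hi : ∀ i j, Integrable (fun x => T.stress (field w) x i j ^ 2)
        (volume.restrict T.domain) := fun i j =>
      ((memLp_stress w i j).restrict T.domain).integrable_sq
    rw [integral_finsetSum _ fun i _ => integrable_finsetSum _ fun j _ => hi i j,
      Fintype.sum_prod_type]
    refine Finset.sum_congr rfl fun i _ => ?_
    rw [integral_finsetSum _ fun j _ => hi i j]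
    refine Finset.sum_congr rfl fun j _ => ?_
    simp only [normPart, Sum.elim_inl]
    rw [← ENNReal.toReal_pow, eLpNorm_two_sq_eq_integral (hi i j),
      ENNReal.toReal_ofReal (integral_nonneg fun x => sq_nonneg _)]
  · refine Finset.sum_congr rfl fun F _ => ?_
    simp only [normPart, Sum.elim_inr]
    rw [mul_pow, Real.sq_sqrt (show 0 ≤ (faceDiam F)⁻¹ from inv_nonneg.2 diam_nonneg)]

lemma normPart_add_le (hd : 0 < d) (σ : T.Orientation) (v w : T.brokenH1) {k} (hk : k ∈ parts T) :
    normPart σ (v + w) k ≤ normPart σ v k + normPart σ w k := by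
  have e : v + w = v + (1 : ℝ) • w := by rw [one_smul]
  rcases k with q | F
  · simp only [normPart, Sum.elim_inl]
    have hv := (memLp_stress v q.1 q.2).restrict T.domain
    have hw := (memLp_stress w q.1 q.2).restrict T.domain
    rw [← ENNReal.toReal_add hv.2.ne hw.2.ne]
    refine ENNReal.toReal_mono (ENNReal.add_ne_top.2 ⟨hv.2.ne, hw.2.ne⟩) ?_
    refine le_trans (le_of_eq (eLpNorm_congr_ae ?_)) (eLpNorm_add_le hv.1 hw.1 (by norm_num))
    rw [e]
    filter_upwards [ae_restrict_of_ae (stress_add_smul v w 1)] with x hx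
    rw [hx]
    simp
  · have hF : F ∈ T.meshFaces := by simpa [parts] using hk
    simp only [normPart, Sum.elim_inr]
    rw [e, jump_add_smul hd σ v w 1 hF, one_smul, ← mul_add]
    exact mul_le_mul_of_nonneg_left (norm_add_le _ _) (Real.sqrt_nonneg _)

lemma normPart_smul (hd : 0 < d) (σ : T.Orientation) (w : T.brokenH1) (c : ℝ) {k}
    (hk : k ∈ parts T) : normPart σ (c • w) k = |c| * normPart σ w k := by
  -- Scaling is expressed in the form `v + c • w` covered by the linearity lemmas.
  have e : c • w = w + (c - 1) • w := by rw [sub_smul, one_smul]; abel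
  rcases k with q | F
  · simp only [normPart, Sum.elim_inl]
    have h : (fun x => T.stress (field (c • w)) x q.1 q.2) =ᵐ[volume.restrict T.domain]
        c • fun x => T.stress (field w) x q.1 q.2 := by
      rw [e]
      filter_upwards [ae_restrict_of_ae (stress_add_smul w w (c - 1))] with x hx
      rw [hx]
      simp only [Matrix.add_apply, Matrix.smul_apply, smul_eq_mul, Pi.smul_apply]
      ring
    rw [eLpNorm_congr_ae h, eLpNorm_const_smul, ENNReal.toReal_mul, toReal_enorm, Real.norm_eq_abs]
  · have hF : F ∈ T.meshFaces := by simpa [parts] using hk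
    simp only [normPart, Sum.elim_inr]
    have h : jump σ (field (c • w)) F = c • jump σ (field w) F := by
      rw [e, jump_add_smul hd σ w w (c - 1) hF, sub_smul, one_smul]
      abel
    rw [h, norm_smul, Real.norm_eq_abs]
    ring

lemma symNorm_smul (hd : 0 < d) (σ : T.Orientation) (w : T.brokenH1) (c : ℝ) :
    symNorm σ (c • w) = |c| * symNorm σ w := by
  rw [symNorm_eq, symNorm_eq, Finset.sum_congr rfl fun k hk => by
    rw [normPart_smul hd σ w c hk, mul_pow], ← Finset.mul_sum,
    Real.sqrt_mul (sq_nonneg _), Real.sqrt_sq (abs_nonneg c)]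

lemma symNorm_add_le (hd : 0 < d) (σ : T.Orientation) (v w : T.brokenH1) :
    symNorm σ (v + w) ≤ symNorm σ v + symNorm σ w := by
  simp only [symNorm_eq]
  calc √(∑ k ∈ parts T, normPart σ (v + w) k ^ 2)
      ≤ √(∑ k ∈ parts T, (normPart σ v k + normPart σ w k) ^ 2) := by
        refine Real.sqrt_le_sqrt (Finset.sum_le_sum fun k hk => ?_)
        exact pow_le_pow_left₀ (normPart_nonneg σ _ k) (normPart_add_le hd σ v w hk) 2
    _ ≤ _ := by
        have h := Real.Lp_add_le_of_nonneg (p := 2) (s := parts T) (f := normPart σ v)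
          (g := normPart σ w) (by norm_num) (fun k _ => normPart_nonneg σ v k)
          (fun k _ => normPart_nonneg σ w k)
        simpa only [Real.rpow_two, ← Real.sqrt_eq_rpow] using h

/-! ### Definiteness -/

lemma faceDiam_pos (hd : 2 ≤ d) (hF : F ∈ T.meshFaces) : 0 < faceDiam F := by
  -- This uses `d ≥ 2`: for `d = 1` a face is a point of diameter `0`, and its jump would get weight
  -- `0⁻¹ = 0`.
  have hcard : 1 < F.card := by rw [(mem_meshFaces.1 hF).2]; omega
  obtain ⟨a, ha, b, hb, hab⟩ := Finset.one_lt_card.1 hcard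
  refine (dist_pos.2 hab).trans_le (dist_le_diam_of_mem
    (F.finite_toSet.isCompact_convexHull (𝕜 := ℝ)).isBounded
    (subset_convexHull ℝ _ ha) (subset_convexHull ℝ _ hb))

lemma stress_ae_eq_zero_and_jump_eq_zero (hd : 2 ≤ d) (σ : T.Orientation) {w : T.brokenH1}
    (h : symNorm σ w = 0) :
    (∀ i j, ∀ᵐ x ∂(volume.restrict T.domain), T.stress (field w) x i j = 0) ∧
      ∀ F ∈ T.meshFaces, jump σ (field w) F = 0 := by
  rw [symNorm_eq, Real.sqrt_eq_zero (Finset.sum_nonneg fun k _ => sq_nonneg _),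
    Finset.sum_eq_zero_iff_of_nonneg fun k _ => sq_nonneg _] at h
  constructor
  · intro i j
    have h1 := h (Sum.inl (i, j)) (by simp [parts])
    have hm := (memLp_stress w i j).restrict T.domain
    simp only [normPart, Sum.elim_inl, sq_eq_zero_iff, ENNReal.toReal_eq_zero_iff, hm.2.ne,
      or_false] at h1
    exact (eLpNorm_eq_zero_iff hm.1 (by norm_num)).1 h1
  · intro F hF
    have h1 := h (Sum.inr F) (by simp [parts, hF])
    have h2 : √(faceDiam F) ≠ 0 := (Real.sqrt_pos.2 (faceDiam_pos hd hF)).ne'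
    simpa [normPart, h2] using h1

/-- The faces of an element are the faces of the mesh contained in it. -/
lemma sum_erase_eq_sum_meshFaces [DecidableEq (Space d)] (hd : 0 < d) (hK : K ∈ T.elements)
    (S : Finset (Space d) → ℝ) :
    ∑ p ∈ K, S (K.erase p) = ∑ F ∈ T.meshFaces with F ⊆ K, S F := by
  have hc := isCell hK
  refine Finset.sum_nbij (fun p => K.erase p) (fun p hp => ?_) (Finset.erase_injOn K)
    (fun F hF => ?_) fun _ _ => rfl
  · have hcard := hc.card_erase hp
    refine Finset.mem_filter.2 ⟨mem_meshFaces.2 ⟨T.down_closed (mem_elements.1 hK).1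
      (K.erase_subset p) (Finset.card_pos.1 (hcard.symm ▸ hd)), hcard⟩, K.erase_subset p⟩
  · obtain ⟨hF, hFK⟩ := Finset.mem_filter.1 hF
    obtain ⟨p, hp, rfl⟩ := hc.exists_erase hFK (mem_meshFaces.1 hF).2
    exact ⟨p, hp, rfl⟩

/-- Pairing with a continuous function is additive on `L²(F)`. -/
lemma exists_addMonoidHom_integral_mul {μ : Measure (Space d)} {φ : Space d → ℝ}
    (hφ : MemLp φ 2 μ) (i : Fin d) :
    ∃ L : Lp (Space d) 2 μ →+ ℝ, ∀ g, L g = ∫ y, g y i * φ y ∂μ := by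
  have hi : ∀ g : Lp (Space d) 2 μ, Integrable (fun y => g y i * φ y) μ := fun g =>
    ((Lp.memLp g).eval_piLp i).integrable_mul hφ
  refine ⟨AddMonoidHom.mk' (fun g => ∫ y, g y i * φ y ∂μ) fun g h => ?_, fun _ => rfl⟩
  rw [← integral_add (hi g) (hi h)]
  refine integral_congr_ae ?_
  filter_upwards [Lp.coeFn_add g h] with y hy
  rw [hy, Pi.add_apply, PiLp.add_apply, add_mul]

open Classical in
/-- The contributions of the elements adjacent to a face cancel if there is no jump. -/
lemma sum_trace_eq_zero (hd : 0 < d) (σ : T.Orientation) (w : T.brokenH1) (hF : F ∈ T.meshFaces)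
    (hj : jump σ (field w) F = 0) {φ : Space d → ℝ} (hφ : Continuous φ) (i : Fin d) :
    ∑ K ∈ T.elements with F ⊆ K, (SignType.sign (side K F) : ℝ) *
      ∫ y, (trace K F (field w) : Space d → Space d) y i * φ y ∂(surfaceMeasure F) = 0 := by
  have hFd := (mem_meshFaces.1 hF).2
  have hp := σ.plus_mem F hF
  have hFp := σ.subset_plus F hF
  have hfin := (isCell hp).isFiniteMeasure_face hd hFp hFd
  obtain ⟨L, hL⟩ := exists_addMonoidHom_integral_mul
    (memLp_surfaceMeasure (F := F) hφ 2) i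
  simp only [← hL]
  -- A vanishing jump expresses the trace from the positive side as the sum of the other traces.
  -- Each of these enters twice, with opposite signs by `sign_side_eq_neg`. On a boundary face the
  -- sum is empty and the trace is zero.
  rw [← Finset.add_sum_erase _ _ (Finset.mem_filter.2 ⟨hp, hFp⟩),
    sub_eq_zero.1 (show trace (σ.plus F) F (field w) - _ = 0 from hj), map_sum, Finset.mul_sum,
    show (T.elements.filter fun K => F ⊆ K).erase (σ.plus F) =
      T.elements.filter fun K => F ⊆ K ∧ K ≠ σ.plus F by
        ext K
        simp only [Finset.mem_erase, Finset.mem_filter]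
        tauto,
    ← Finset.sum_add_distrib]
  refine Finset.sum_eq_zero fun K hK => ?_
  obtain ⟨hK, hFK, hne⟩ := Finset.mem_filter.1 hK
  rw [sign_side_eq_neg hd hp hK hne.symm hFp hFK hFd, SignType.coe_neg]
  ring

lemma brokenGrad_eq_zero (w : Space d → Space d) {x : Space d} (hx : x ∉ T.domain) :
    T.brokenGrad w x = 0 := by
  ext i j
  simp only [brokenGrad, Matrix.of_apply, Matrix.zero_apply]
  exact Finset.sum_eq_zero fun K hK =>
    indicator_of_notMem (fun h => hx (T.openCell_subset_domain hK h)) _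

/-- A broken field without jumps, extended by zero, is weakly differentiable in `ℝ^d`. -/
lemma hasWeakPartial_indicator_domain (hd : 0 < d) (σ : T.Orientation) (w : T.brokenH1)
    (hj : ∀ F ∈ T.meshFaces, jump σ (field w) F = 0) (i j : Fin d) :
    HasWeakPartial univ (T.domain.indicator fun x => field w x i) j
      fun x => T.brokenGrad (field w) x i j := by
  classical
  intro φ hφ hc _
  have hdφ := memLp_testFunction_fderiv T.domain hφ hc (EuclideanSpace.single j 1)
  have h1 : ∫ x, T.domain.indicator (fun x => field w x i) x *
        fderiv ℝ φ x (EuclideanSpace.single j 1) =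
      ∑ K ∈ T.elements, ∫ x in openCell K, field w x i *
        fderiv ℝ φ x (EuclideanSpace.single j 1) := by
    have e : IntegrableOn
        (fun x => field w x i * fderiv ℝ φ x (EuclideanSpace.single j 1)) T.domain :=
      ((memLp_field w).eval_piLp i).integrable_mul hdφ
    rw [← setIntegral_domain e,
      ← integral_indicator (s := T.domain) isOpen_interior.measurableSet]
    refine integral_congr_ae (ae_of_all _ fun x => ?_)
    by_cases hx : x ∈ T.domain
    · simp [indicator_of_mem hx]
    · simp [indicator_of_notMem hx]
  have h2 : ∫ x, T.brokenGrad (field w) x i j * φ x =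
      ∑ K ∈ T.elements, ∫ x in openCell K,
        weakPartial (openCell K) (fun y => field w y i) j x * φ x := by
    have e : ∀ K ∈ T.elements, IntegrableOn
        (fun x => weakPartial (openCell K) (fun y => field w y i) j x * φ x) (openCell K) :=
      fun K hK => ((memH1_field w hK i).weakPartial_spec j).1.integrable_mul
        (memLp_testFunction (openCell K) hφ hc)
    simp only [brokenGrad, Matrix.of_apply, Finset.sum_mul, ← indicator_mul_left]
    rw [integral_finsetSum _ fun K hK =>
      (integrable_indicator_iff (s := openCell K) isOpen_interior.measurableSet).2 (e K hK)]
    exact Finset.sum_congr rfl fun K _ => integral_indicator isOpen_interior.measurableSet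
  -- Green's formula on each element, followed by an exchange of summation: the sum over the faces
  -- of each element becomes, for each face, a sum over its adjacent elements.
  rw [Measure.restrict_univ, h1, h2, eq_neg_iff_add_eq_zero, ← Finset.sum_add_distrib,
    Finset.sum_congr rfl fun K hK => (isCell hK).integral_mul_fderiv_add hd
      (memH1_field w hK) hφ i j,
    Finset.sum_congr rfl fun K hK => sum_erase_eq_sum_meshFaces hd hK fun F =>
      (SignType.sign (side K F) : ℝ) * ⟪faceNormal F, EuclideanSpace.single j 1⟫ *
        ∫ y, (trace K F (field w) : Space d → Space d) y i * φ y ∂(surfaceMeasure F),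
    Finset.sum_comm' (s' := fun F => T.elements.filter fun K => F ⊆ K) (t' := T.meshFaces)
      (by simp only [Finset.mem_filter]; tauto)]
  refine Finset.sum_eq_zero fun F hF => ?_
  rw [← mul_zero ⟪faceNormal F, EuclideanSpace.single j (1 : ℝ)⟫,
    ← sum_trace_eq_zero hd σ w hF (hj F hF) hφ.continuous i, Finset.mul_sum]
  refine Finset.sum_congr rfl fun K _ => ?_
  ring

lemma isBounded_domain (T : SimplicialMesh d) : Bornology.IsBounded T.domain := by
  refine Bornology.IsBounded.subset ?_ (interior_subset (s := T.space))
  exact (Bornology.isBounded_biUnion T.finite_faces).2 fun s _ =>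
    (s.finite_toSet.isCompact_convexHull (𝕜 := ℝ)).isBounded

/-- The zero extension has compact support and its weak gradient is the broken gradient. Both sides
of the stress relation vanish outside the domain, so the relation holds in all of `ℝ^d` and rigidity
applies. -/
lemma eq_zero_of_symNorm_eq_zero (hd : 2 ≤ d) (σ : T.Orientation) {w : T.brokenH1}
    (h : symNorm σ w = 0) : w = 0 := by
  have hd0 : 0 < d := by omega
  obtain ⟨hs, hj⟩ := stress_ae_eq_zero_and_jump_eq_zero hd σ h
  have hm : MeasurableSet T.domain := isOpen_interior.measurableSet
  have hz : ∀ i, (T.domain.indicator fun x => field w x i) =ᵐ[volume] 0 := by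
    refine ae_eq_zero_of_weakPartial_symm (g := fun i j x => T.brokenGrad (field w) x i j) hd0
      (fun i => ?_) (fun i => ?_) (fun i j => ?_)
      (hasWeakPartial_indicator_domain hd0 σ w hj) fun i j => ?_
    · exact ((memLp_indicator_iff_restrict hm).2 ((memLp_field w).eval_piLp i)).locallyIntegrable
        (by norm_num)
    · exact HasCompactSupport.intro (isBounded_domain T).isCompact_closure fun x hx =>
        indicator_of_notMem (fun h => hx (subset_closure h)) _
    · exact (memLp_brokenGrad w i j).locallyIntegrable (by norm_num)
    · filter_upwards [(ae_restrict_iff' hm).1 (hs i j)] with x hx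
      by_cases hxT : x ∈ T.domain
      · have := hx hxT
        rw [stress_apply] at this
        exact sub_eq_zero.1 this
      · simp [brokenGrad_eq_zero _ hxT]
  refine Subtype.ext ((Lp.eq_zero_iff_ae_eq_zero).2 ?_)
  filter_upwards [ae_restrict_of_ae (ae_all_iff.2 hz), ae_restrict_mem hm] with x hx hxT
  ext i
  have := hx i
  rwa [indicator_of_mem hxT] at this

lemma symNorm_eq_zero_iff (hd : 2 ≤ d) (σ : T.Orientation) {w : T.brokenH1} :
    symNorm σ w = 0 ↔ w = 0 := by
  refine ⟨eq_zero_of_symNorm_eq_zero hd σ, ?_⟩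
  rintro rfl
  simpa using symNorm_smul (by omega) σ (0 : T.brokenH1) 0

lemma existsUnique_hasTrace (hd : 0 < d) (w : T.brokenH1) (hK : K ∈ T.elements)
    (hF : F ∈ T.meshFaces) (hFK : F ⊆ K) :
    ∃! g : Lp (Space d) 2 (surfaceMeasure F), HasTrace K F (field w) g := by
  have hFd := (mem_meshFaces.1 hF).2
  have hw := memH1_field w hK
  obtain ⟨g, hg⟩ := (isCell hK).exists_hasTrace hd hFK hFd hw
  exact ⟨g, hg, fun g' hg' => (isCell hK).hasTrace_unique hd hFK hFd hw hg' hg⟩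

end SimplicialMesh

end BrokenSobolev

end

theorem mainTheorem1 (d : ℕ) (hd : d = 2 ∨ d = 3) (T : BrokenSobolev.SimplicialMesh d)
    (σ : T.Orientation) :
    -- the traces entering the jumps are well defined
    (∀ w : T.brokenH1, ∀ K ∈ T.elements, ∀ F ∈ T.meshFaces, F ⊆ K →
      ∃! g : MeasureTheory.Lp (BrokenSobolev.Space d) 2 (BrokenSobolev.surfaceMeasure F),
        BrokenSobolev.HasTrace K F (BrokenSobolev.SimplicialMesh.field w) g) ∧
    -- norm axioms on the broken Sobolev space
    (∀ w : T.brokenH1, 0 ≤ BrokenSobolev.SimplicialMesh.symNorm σ w) ∧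
    (∀ w : T.brokenH1, BrokenSobolev.SimplicialMesh.symNorm σ w = 0 ↔ w = 0) ∧
    (∀ (c : ℝ) (w : T.brokenH1), BrokenSobolev.SimplicialMesh.symNorm σ (c • w) =
      |c| * BrokenSobolev.SimplicialMesh.symNorm σ w) ∧
    (∀ v w : T.brokenH1, BrokenSobolev.SimplicialMesh.symNorm σ (v + w) ≤
      BrokenSobolev.SimplicialMesh.symNorm σ v + BrokenSobolev.SimplicialMesh.symNorm σ w) := by
  have hd2 : 2 ≤ d := by omega
  have hd0 : 0 < d := by omega
  exact ⟨fun w K hK F hF hFK =>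
      BrokenSobolev.SimplicialMesh.existsUnique_hasTrace hd0 w hK hF hFK,
    fun _ => Real.sqrt_nonneg _,
    fun _ => BrokenSobolev.SimplicialMesh.symNorm_eq_zero_iff hd2 σ,
    fun c w => BrokenSobolev.SimplicialMesh.symNorm_smul hd0 σ w c,
    BrokenSobolev.SimplicialMesh.symNorm_add_le hd0 σ⟩
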